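/- **Setting.** For each $d\in\mathbb N=\{1,2,\dots\}$ let $D_d\subset\mathbb R^d$ be a Borel set of positive Lebesgue measure, $\rho_d$ a Borel measurable probability density on $D_d$, $G_d=L_2(D_d,\rho_d(x)\,dx)$ (real-valued), and let $F_d$ be a separable real Hilbert space of Borel measurable functions on $D_d$ that is compactly embedded in $G_d$ by $\mathrm{APP}_df=f$; point evaluations need not be continuous on $F_d$. Let $\mathrm{APP}=\{\mathrm{APP}_d\}_{d\in\mathbb N}$. Let $\Lambda^{\rm all}$ be the class of all linear functionals on $F_d$ (continuous or not) and $\Lambda^{\rm std}$ the class of all function values $f\mapsto f(x)$, $x\in D_d$. For $\Lambda\in\{\Lambda^{\rm all},\Lambda^{\rm std}\}$ a randomized algorithm is a family $A^\omega(f)=\phi_{\omega}(L_{1,\omega}(f),\dots,L_{n,\omega}(f))\in G_d$ with $L_{j,\omega}\in\Lambda$, indexed by a probability space $(\Omega,\Sigma,\mathcal P)$. For fixed $\omega$ the number $n=n(f,\omega)<\infty$ is determined by a termination criterion that after $k$ steps depends only on the $k$ values computed so far, and $\phi_\omega$ restricted to $\mathbb R^k$ is measurable for each $k$; moreover $(f,\omega)\mapsto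 A^\omega(f)$ and $(f,\omega)\mapsto n(f,\omega)$ are jointly measurable when $f$ ranges over a finite-dimensional subspace of $F_d$. Put $$\mathrm{Card}(A)=\sup_{\|f\|_{F_d}\le1}\mathbb E_\omega n(f,\omega),\qquad e(A)=\sup_{\|f\|_{F_d}\le1}\big(\mathbb E_\omega\|f-A^\omega(f)\|_{G_d}^2\big)^{1/2},$$ $e(0,d;\Lambda)=\sup_{\|f\|_{F_d}\le 1}\|f\|_{G_d}$, and, for $n\ge1$, $e(n,d;\Lambda)=\inf\{e(A): A \text{ uses }\Lambda,\ \mathrm{Card}(A)\le n\}$. The information complexity is $$N(\varepsilon,d;\Lambda)=\inf\{n\in\mathbb N_0: e(n,d;\Lambda)\le\varepsilon\,\mathrm{CRI}_d\},$$ where $\mathrm{CRI}_d=1$ for the absolute error criterion and $\mathrm{CRI}_d=e(0,d;\Lambda)$ for the normalized one. With a fixed criterion, and with the convention $\ln 0=0$ for the logarithm of $N$, $\mathrm{APP}$ is said to be, for the class $\Lambda$, * EXP-SPT if there are $C>0$, $p\ge0$ with $N(\varepsilon,d;\Lambda)\le C(1+\ln\varepsilon^{-1})^p$ for all $d\in\mathbb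 N$, $\varepsilon\in(0,1)$; the exponent is the infimum of such $p$; * EXP-PT if there are $C>0$, $p,q\ge0$ with $N(\varepsilon,d;\Lambda)\le Cd^q(1+\ln\varepsilon^{-1})^p$ for all $d\in\mathbb N$, $\varepsilon\in(0,1)$; * EXP-QPT if there are $C>0$, $t\ge0$ with $N(\varepsilon,d;\Lambda)\le C\exp\big(t(1+\ln d)(1+\ln(1+\ln\varepsilon^{-1}))\big)$ for all $d\in\mathbb N$, $\varepsilon\in(0,1)$; the exponent is the infimum of such $t$; * EXP-$(s,t)$-WT ($s,t>0$) if $\displaystyle\lim_{\varepsilon^{-1}+d\to\infty}\frac{\ln N(\varepsilon,d;\Lambda)}{(1+\ln\varepsilon^{-1})^s+d^t}=0$ (over $\varepsilon\in(0,1)$, $d\in\mathbb N$); EXP-WT if this holds for $s=t=1$; EXP-UWT if it holds for all $s,t>0$; * ALG-$(s,t)$-WT ($s,t>0$) if $\displaystyle\lim_{\varepsilon^{-1}+d\to\infty}\frac{\ln N(\varepsilon,d;\Lambda)}{\varepsilon^{-s}+d^t}=0$; ALG-UWT if this holds for all $s,t>0$. **Theorem 2.6.** For the absolute and for the normalized error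 criterion, and for all $s,t>0$: each of EXP-SPT, EXP-PT, EXP-QPT, EXP-UWT, EXP-WT, EXP-$(s,t)$-WT, ALG-UWT and ALG-$(s,t)$-WT holds for $\Lambda^{\rm all}$ if and only if it holds for $\Lambda^{\rm std}$. Moreover, the exponents of EXP-SPT for $\Lambda^{\rm all}$ and $\Lambda^{\rm std}$ are the same, and so are the exponents of EXP-QPT (an exponent being $\infty$ if the property fails). All of this is also true if, for $\Lambda^{\rm std}$, only those algorithms are admitted whose nodes are random points of $D_d$ each having a distribution that is absolutely continuous with respect to $\rho_d(x)\,dx$, so that the functions need to be defined only almost everywhere. -/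

import Mathlib

open MeasureTheory Filter Topology
open scoped ENNReal NNReal

universe u

noncomputable section

namespace RandApprox

/-- Lebesgue measure on the subset `D` of `ℝ^d`. -/
def lebesgue {d : ℕ} (D : Set (EuclideanSpace ℝ (Fin d))) : Measure D :=
  (volume : Measure (EuclideanSpace ℝ (Fin d))).comap Subtype.val

/-- The measure `ρ(x) dx` on `D`. -/
def density {d : ℕ} (D : Set (EuclideanSpace ℝ (Fin d))) (ρ : D → ℝ) : Measure D :=
  (lebesgue D).withDensity fun x => ENNReal.ofReal (ρ x)

/-- A separable real Hilbert space `F` of Borel measurable functions on a Borel set `D ⊆ ℝ^d` of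
positive Lebesgue measure, all of them square integrable with respect to a probability density `ρ`
on `D`. The elements of `F` are identified with functions through the injective linear map `eval`;
point evaluations need not be continuous on `F`. -/
structure FunctionSpace (d : ℕ) where
  /-- the domain -/
  D : Set (EuclideanSpace ℝ (Fin d))
  measurableSet_D : MeasurableSet D
  volume_D_pos : 0 < volume D
  /-- the probability density -/
  ρ : D → ℝ
  measurable_ρ : Measurable ρ
  ρ_nonneg : ∀ x, 0 ≤ ρ x
  lintegral_ρ : ∫⁻ x, ENNReal.ofReal (ρ x) ∂(lebesgue D) = 1
  /-- the Hilbert space of functions -/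
  F : Type u
  [normedAddCommGroup : NormedAddCommGroup F]
  [innerProductSpace : InnerProductSpace ℝ F]
  [completeSpace : CompleteSpace F]
  [separableSpace : TopologicalSpace.SeparableSpace F]
  /-- the function given by an element of `F` -/
  eval : F →ₗ[ℝ] (D → ℝ)
  eval_injective : Function.Injective eval
  measurable_eval : ∀ f, Measurable (eval f)
  memLp_eval : ∀ f, MemLp (eval f) 2 (density D ρ)

attribute [instance] FunctionSpace.normedAddCommGroup FunctionSpace.innerProductSpace
  FunctionSpace.completeSpace FunctionSpace.separableSpace

namespace FunctionSpace

variable {d : ℕ} (P : FunctionSpace.{u} d)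

/-- The target space `G = L₂(D, ρ(x) dx)`. -/
abbrev G : Type := Lp ℝ 2 (density P.D P.ρ)

/-- The embedding `APP f = f` of `F` into `G`. -/
def app : P.F →ₗ[ℝ] P.G where
  toFun f := MemLp.toLp (P.eval f) (P.memLp_eval f)
  map_add' f g := by
    rw [← MemLp.toLp_add]
    exact MemLp.toLp_congr _ _ (by rw [map_add])
  map_smul' c f := by
    rw [RingHom.id_apply, ← MemLp.toLp_const_smul]
    exact MemLp.toLp_congr _ _ (by rw [map_smul])

end FunctionSpace

/-- The `d`-variate approximation problem: a function space whose embedding into `G` is compact. -/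
structure ApproxProblem (d : ℕ) extends FunctionSpace.{u} d where
  isCompact_app : IsCompactOperator toFunctionSpace.app

/-- The classes of information: `all` is `Λ^all`. The class `Λ^std` comes in two versions: in `std`
functions may be evaluated at arbitrary points of `D`; `stdAE` is meant for functions that are
defined only almost everywhere, see `RandAlg.nodes_ae`. -/
inductive InfoClass
  | all
  | std
  | stdAE

/-- `all` consists of all linear functionals on `F`, continuous or not; `std` and `stdAE` consist of the
function values `f ↦ f x` at the points `x` of `D`. -/
def InfoClass.functionals {d : ℕ} (P : ApproxProblem.{u} d) : InfoClass → Set (P.F →ₗ[ℝ] ℝ)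
  | .all => Set.univ
  | .std | .stdAE => {L | ∃ x : P.D, ∀ f, L f = P.eval f x}

/-- A deterministic method with information from `Λ`: the values `L₀ f, L₁ f, …` are computed one
after the other until a termination criterion, which sees only the values computed so far, is
satisfied; then the output is a measurable function of these values. -/
structure Method {d : ℕ} (P : ApproxProblem.{u} d) (Λ : InfoClass) where
  L : ℕ → P.F →ₗ[ℝ] ℝ
  L_mem : ∀ j, L j ∈ Λ.functionals P
  /-- the termination criterion after `k` values -/
  halt : (k : ℕ) → (Fin k → ℝ) → Prop
  /-- the output when the method terminates after `k` values -/
  φ : (k : ℕ) → (Fin k → ℝ) → P.G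
  φ_measurable : ∀ k, StronglyMeasurable (φ k)
  terminates : ∀ f, ∃ k, halt k fun j => L j f

namespace Method

variable {d : ℕ} {P : ApproxProblem.{u} d} {Λ : InfoClass} (A : Method P Λ)

/-- The number `n(f)` of information values used for the input `f`. -/
def numInfo (f : P.F) : ℕ := sInf {k | A.halt k fun j => A.L j f}

/-- The output `φ (L₁ f, …, Lₙ f)` with `n = n(f)`. -/
def run (f : P.F) : P.G := A.φ (A.numInfo f) fun j => A.L j f

end Method

/-- A randomized algorithm: a family of deterministic methods indexed by a probability space. The
output and the number of information values are jointly measurable functions of the random element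
and of the input, as the input ranges over (a parametrization of) a finite dimensional subspace
of `F`. -/
structure RandAlg {d : ℕ} (P : ApproxProblem.{u} d) (Λ : InfoClass) where
  Ω : Type
  [measurableSpace : MeasurableSpace Ω]
  prob : Measure Ω
  [isProbabilityMeasure : IsProbabilityMeasure prob]
  method : Ω → Method P Λ
  measurable_run : ∀ (k : ℕ) (b : Fin k → P.F),
    StronglyMeasurable fun p : (Fin k → ℝ) × Ω => (method p.2).run (∑ i, p.1 i • b i)
  measurable_numInfo : ∀ (k : ℕ) (b : Fin k → P.F),
    Measurable fun p : (Fin k → ℝ) × Ω => (method p.2).numInfo (∑ i, p.1 i • b i)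
  /-- For the class `stdAE` every node is a random point whose law is absolutely continuous with
  respect to `ρ(x) dx`. Hence for each `f` the information used almost surely does not depend on the
  values of `f` on a null set. -/
  nodes_ae : Λ = .stdAE → ∀ j, ∃ x : Ω → P.D, Measurable x ∧ prob.map x ≪ density P.D P.ρ ∧
    ∀ ω f, (method ω).L j f = P.eval f (x ω)

attribute [instance] RandAlg.measurableSpace RandAlg.isProbabilityMeasure

namespace RandAlg

variable {d : ℕ} {P : ApproxProblem.{u} d} {Λ : InfoClass} (A : RandAlg P Λ)

/-- The cardinality `sup_{‖f‖ ≤ 1} 𝔼 n(f, ω)`. -/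
def card : ℝ≥0∞ :=
  ⨆ (f : P.F) (_ : ‖f‖ ≤ 1), ∫⁻ ω, ((A.method ω).numInfo f : ℝ≥0∞) ∂A.prob

/-- The randomized error `sup_{‖f‖ ≤ 1} (𝔼 ‖APP f - A^ω f‖²)^{1/2}`. -/
def err : ℝ≥0∞ :=
  ⨆ (f : P.F) (_ : ‖f‖ ≤ 1), (∫⁻ ω, ‖P.app f - (A.method ω).run f‖ₑ ^ 2 ∂A.prob) ^ (1 / 2 : ℝ)

end RandAlg

/-- The initial error, i.e. the error of the zero algorithm. -/
def initialError {d : ℕ} (P : ApproxProblem.{u} d) : ℝ≥0∞ :=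
  ⨆ (f : P.F) (_ : ‖f‖ ≤ 1), ‖P.app f‖ₑ

/-- The `n`th minimal randomized error; for `n = 0` only the zero algorithm is used. -/
def minError {d : ℕ} (P : ApproxProblem.{u} d) (Λ : InfoClass) : ℕ → ℝ≥0∞
  | 0 => initialError P
  | n + 1 => ⨅ (A : RandAlg P Λ) (_ : A.card ≤ ((n + 1 : ℕ) : ℝ≥0∞)), A.err

/-- The absolute and the normalized error criterion. -/
inductive Criterion
  | ABS
  | NOR

/-- The factor `CRI` of the error threshold. -/
def Criterion.cri {d : ℕ} (P : ApproxProblem.{u} d) : Criterion → ℝ≥0∞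
  | .ABS => 1
  | .NOR => initialError P

/-- The information complexity `n(ε, d; Λ)` in the randomized setting (`⊤` if no `n` suffices). -/
def infoComplexity (APP : (d : ℕ+) → ApproxProblem.{u} d) (c : Criterion) (Λ : InfoClass)
    (ε : ℝ) (d : ℕ+) : ℕ∞ :=
  ⨅ (n : ℕ) (_ : minError (APP d) Λ n ≤ ENNReal.ofReal ε * c.cri (APP d)), (n : ℕ∞)

/-! ### Notions of tractability of an information complexity `N ε d` -/

/-- `N ε d ≤ C (1 + ln ε⁻¹)^p` for all `d` and all `ε ∈ (0, 1)`, with some `C > 0`. -/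
def ExpSPTBound (N : ℝ → ℕ+ → ℕ∞) (p : ℝ) : Prop :=
  ∃ C : ℝ, 0 < C ∧ ∀ (d : ℕ+), ∀ ε ∈ Set.Ioo (0 : ℝ) 1,
    (N ε d : ℝ≥0∞) ≤ ENNReal.ofReal (C * (Real.log ε⁻¹ + 1) ^ p)

/-- Exponential strong polynomial tractability. -/
def ExpSPT (N : ℝ → ℕ+ → ℕ∞) : Prop := ∃ p : ℝ, 0 ≤ p ∧ ExpSPTBound N p

/-- The exponent of EXP-SPT (`⊤` if EXP-SPT does not hold). -/
def expSPTExponent (N : ℝ → ℕ+ → ℕ∞) : ℝ≥0∞ := ⨅ (p : ℝ≥0) (_ : ExpSPTBound N p), (p : ℝ≥0∞)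

/-- Exponential polynomial tractability. -/
def ExpPT (N : ℝ → ℕ+ → ℕ∞) : Prop :=
  ∃ C p q : ℝ, 0 < C ∧ 0 ≤ p ∧ 0 ≤ q ∧ ∀ (d : ℕ+), ∀ ε ∈ Set.Ioo (0 : ℝ) 1,
    (N ε d : ℝ≥0∞) ≤ ENNReal.ofReal (C * (d : ℝ) ^ q * (Real.log ε⁻¹ + 1) ^ p)

/-- `N ε d ≤ C exp(t (1 + ln d) (1 + ln(1 + ln ε⁻¹)))` for all `d` and all `ε ∈ (0, 1)`, with some
`C > 0`. -/
def ExpQPTBound (N : ℝ → ℕ+ → ℕ∞) (t : ℝ) : Prop :=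
  ∃ C : ℝ, 0 < C ∧ ∀ (d : ℕ+), ∀ ε ∈ Set.Ioo (0 : ℝ) 1,
    (N ε d : ℝ≥0∞) ≤ ENNReal.ofReal
      (C * Real.exp (t * (1 + Real.log d) * (1 + Real.log (Real.log ε⁻¹ + 1))))

/-- Exponential quasi-polynomial tractability. -/
def ExpQPT (N : ℝ → ℕ+ → ℕ∞) : Prop := ∃ t : ℝ, 0 ≤ t ∧ ExpQPTBound N t

/-- The exponent of EXP-QPT (`⊤` if EXP-QPT does not hold). -/
def expQPTExponent (N : ℝ → ℕ+ → ℕ∞) : ℝ≥0∞ := ⨅ (t : ℝ≥0) (_ : ExpQPTBound N t), (t : ℝ≥0∞)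

/-- `ε⁻¹ + d → ∞` with `ε ∈ (0, 1)` and `d ∈ {1, 2, …}`. -/
def weakFilter : Filter (ℝ × ℕ+) :=
  comap (fun p => p.1⁻¹ + (p.2 : ℝ)) atTop ⊓ 𝓟 {p | p.1 ∈ Set.Ioo (0 : ℝ) 1}

/-- `ln n`, with the convention `ln 0 = 0` (and `ln ∞ = ∞`). -/
def lnCard (n : ℕ∞) : ℝ≥0∞ := if n = ⊤ then ⊤ else ENNReal.ofReal (Real.log n.toNat)

/-- Exponential `(s, t)`-weak tractability. -/
def ExpSTWT (N : ℝ → ℕ+ → ℕ∞) (s t : ℝ) : Prop :=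
  Tendsto (fun p : ℝ × ℕ+ =>
    lnCard (N p.1 p.2) / ENNReal.ofReal ((1 + Real.log p.1⁻¹) ^ s + (p.2 : ℝ) ^ t))
    weakFilter (𝓝 0)

/-- Exponential weak tractability. -/
def ExpWT (N : ℝ → ℕ+ → ℕ∞) : Prop :=
  Tendsto (fun p : ℝ × ℕ+ =>
    lnCard (N p.1 p.2) / ENNReal.ofReal (1 + Real.log p.1⁻¹ + (p.2 : ℝ)))
    weakFilter (𝓝 0)

/-- Exponential uniform weak tractability. -/
def ExpUWT (N : ℝ → ℕ+ → ℕ∞) : Prop := ∀ α β : ℝ, 0 < α → 0 < β → ExpSTWT N α β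

/-- Algebraic `(s, t)`-weak tractability. -/
def AlgSTWT (N : ℝ → ℕ+ → ℕ∞) (s t : ℝ) : Prop :=
  Tendsto (fun p : ℝ × ℕ+ =>
    lnCard (N p.1 p.2) / ENNReal.ofReal (p.1⁻¹ ^ s + (p.2 : ℝ) ^ t))
    weakFilter (𝓝 0)

/-- Algebraic uniform weak tractability. -/
def AlgUWT (N : ℝ → ℕ+ → ℕ∞) : Prop := ∀ α β : ℝ, 0 < α → 0 < β → AlgSTWT N α β

end RandApprox

end

/-! Everything follows from one comparison, `exists_infoComplexity_std_le`: for each `δ ∈ (0, 1]`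
the complexity for function values at `ε` is at most `C` times the `(1 + δ)`-th power of the
complexity for arbitrary functionals at `ε / (1 + δ)`, with `C` depending on `δ` alone. The
tractability notions tolerate such a change, and `δ → 0` preserves the exponents. Both complexities
are compared with the number `m` of singular values of the embedding above a threshold `s`.

Lower bound (`RandAlg.le_err_sq`, `IsLargeEigenfamily.card_le`): choose the input uniformly on the
unit sphere spanned by the `m` singular vectors. If the functionals used are few compared with `m`,
then flipping the component of the input in their common kernel changes no information, so the error
is hardly below `s`. Hence `m` is at most a constant times the complexity for arbitrary functionals.

Upper bound (`exists_estimator`, `IsLargeEigenfamily.minError_le`): write `f` as a combination of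
the `m` eigenfunctions plus a remainder `g` with norm at most `s` in `G`. Interpolation at `m`
random points with density proportional to the squared collocation determinant recovers the
coefficients with mean square error `m ‖g‖²`. Each further point, drawn from the Christoffel
density, serves for a step of stochastic gradient descent, which contracts the error by `1 - θ / m`
and adds only `θ² / m ‖g‖²`. After about `(m / θ) log (m / θ)` steps the error is at most `2 θ
‖g‖²`. The logarithm is what costs the power `1 + δ`. -/

namespace RandApprox
open scoped InnerProductSpace

/-! ### Singular values of compact operators -/

section Spectral

variable {F G : Type*} [NormedAddCommGroup F] [InnerProductSpace ℝ F]
  [NormedAddCommGroup G] [InnerProductSpace ℝ G]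

/-- Orthonormal eigenvectors of `A† A` with eigenvalues above `s²`. -/
def IsLargeEigenfamily (A : F →L[ℝ] G) (s : ℝ) {m : ℕ} (e : Fin m → F) (l : Fin m → ℝ) : Prop :=
  Orthonormal ℝ e ∧ (∀ i f, ⟪A (e i), A f⟫_ℝ = l i * ⟪e i, f⟫_ℝ) ∧ ∀ i, s ^ 2 < l i

lemma IsLargeEigenfamily.norm_sq {A : F →L[ℝ] G} {s : ℝ} {m : ℕ} {e : Fin m → F} {l : Fin m → ℝ}
    (h : IsLargeEigenfamily A s e l) (i : Fin m) : ‖A (e i)‖ ^ 2 = l i := by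
  rw [← real_inner_self_eq_norm_sq, h.2.1 i, real_inner_self_eq_norm_sq, h.1.1 i]
  simp

lemma IsLargeEigenfamily.inner_eq_zero {A : F →L[ℝ] G} {s : ℝ} {m : ℕ} {e : Fin m → F}
    {l : Fin m → ℝ} (h : IsLargeEigenfamily A s e l) {i j : Fin m} (hij : i ≠ j) :
    ⟪A (e i), A (e j)⟫_ℝ = 0 := by
  rw [h.2.1 i, h.1.2 hij, mul_zero]

/-- By compactness there is a bound for the number of large eigenvalues. -/
lemma exists_bound_card_of_isLargeEigenfamily {A : F →L[ℝ] G} (hA : IsCompactOperator A) {s : ℝ}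
    (hs : 0 < s) : ∃ M : ℕ, ∀ (m : ℕ) (e : Fin m → F) (l : Fin m → ℝ),
      IsLargeEigenfamily A s e l → m ≤ M := by
  obtain ⟨K, hK, hAK⟩ := hA.image_closedBall_subset_compact (f := A.toLinearMap) 1
  obtain ⟨t, htf, ht⟩ := Metric.totallyBounded_iff.1 hK.totallyBounded (s / 2) (by positivity)
  classical
  refine ⟨htf.toFinset.card, fun m e l h => ?_⟩
  have hmem : ∀ i, ∃ y ∈ t, dist (A (e i)) y < s / 2 := fun i => by
    have : A (e i) ∈ K := hAK ⟨e i, by simp [h.1.1 i], rfl⟩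
    simpa using ht this
  choose y hyt hy using hmem
  -- Two images in one ball of radius `s / 2` would have distance below `s`, whereas orthogonality
  -- makes their squared distance `l i + l j > 2 s²`.
  have hinj : Function.Injective y := fun i j hij => by
    by_contra hne
    have h1 : dist (A (e i)) (A (e j)) < s := by
      have := dist_triangle_right (A (e i)) (A (e j)) (y i)
      have h2 := hy j
      rw [← hij] at h2
      linarith [hy i]
    have h3 : ‖A (e i) - A (e j)‖ ^ 2 = l i + l j := by
      rw [@norm_sub_sq_real, h.inner_eq_zero hne, h.norm_sq, h.norm_sq]
      ring
    rw [dist_eq_norm] at h1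
    nlinarith [h.2.2 i, h.2.2 j, norm_nonneg (A (e i) - A (e j))]
  simpa using Finset.card_le_card_of_injOn (s := Finset.univ) y (by simpa using hyt)
    hinj.injOn

/-- Compact operators have finitely many singular values above `s > 0`; the operator norm on the
orthogonal complement of the corresponding singular vectors is at most `s`. -/
theorem exists_isLargeEigenfamily [CompleteSpace F] [CompleteSpace G] {A : F →L[ℝ] G}
    (hA : IsCompactOperator A) {s : ℝ} (hs : 0 < s) : ∃ (m : ℕ) (e : Fin m → F) (l : Fin m → ℝ), IsLargeEigenfamily A s e l ∧
      ∀ g, (∀ i, ⟪e i, g⟫_ℝ = 0) → ‖A g‖ ≤ s * ‖g‖ := by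
  obtain ⟨M, hM⟩ := exists_bound_card_of_isLargeEigenfamily hA hs
  let p : ℕ → Prop := fun m => ∃ (e : Fin m → F) (l : Fin m → ℝ), IsLargeEigenfamily A s e l
  classical
  have hp0 : p 0 := ⟨Fin.elim0, Fin.elim0, ⟨fun i => i.elim0, fun i => i.elim0⟩,
    fun i => i.elim0, fun i => i.elim0⟩
  have hspec : p (Nat.findGreatest p M) := Nat.findGreatest_spec (Nat.zero_le M) hp0
  -- A family of maximal size: any eigenvalue above `s²` on the orthogonal complement would enlarge
  -- it.
  set m := Nat.findGreatest p M with hm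
  obtain ⟨e, l, h⟩ := hspec
  have hmax : ¬ p (m + 1) := fun ⟨e', l', h'⟩ =>
    Nat.findGreatest_is_greatest (Nat.lt_succ_self _) (hM _ e' l' h') ⟨e', l', h'⟩
  refine ⟨m, e, l, h, ?_⟩
  let T : F →L[ℝ] F := (ContinuousLinearMap.adjoint A).comp A
  have hT : ∀ x y, ⟪T x, y⟫_ℝ = ⟪A x, A y⟫_ℝ := fun x y => by
    simp [T, ContinuousLinearMap.adjoint_inner_left]
  have hTsymm : T.IsSymmetric := fun x y => by
    change ⟪T x, y⟫_ℝ = ⟪x, T y⟫_ℝ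
    rw [hT, real_inner_comm (T y), hT, real_inner_comm]
  have hTc : IsCompactOperator T := hA.clm_comp (ContinuousLinearMap.adjoint A)
  let U : Submodule ℝ F := (Submodule.span ℝ (Set.range e))ᗮ
  have hU : ∀ g, g ∈ U ↔ ∀ i, ⟪e i, g⟫_ℝ = 0 := fun g => by
    refine ⟨fun hg i => hg _ (Submodule.subset_span ⟨i, rfl⟩), fun hg u hu => ?_⟩
    induction hu using Submodule.span_induction with
    | mem x hx => obtain ⟨i, rfl⟩ := hx; exact hg i
    | zero => simp
    | add x y _ _ hx hy => rw [inner_add_left, hx, hy, add_zero]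
    | smul c x _ hx => rw [real_inner_smul_left, hx, mul_zero]
  have hinv : ∀ g ∈ U, T g ∈ U := fun g hg => by
    rw [hU] at hg ⊢
    intro i
    rw [real_inner_comm, hT, real_inner_comm, h.2.1 i, hg i, mul_zero]
  let S : U →L[ℝ] U := T.restrict hinv
  have hSc : IsCompactOperator S := hTc.restrict' hinv
  have hSs : S.IsSymmetric := hTsymm.restrict_invariant hinv
  have hev : ∀ μ, Module.End.HasEigenvalue (S : Module.End ℝ U) μ → |μ| ≤ s ^ 2 := by
    intro μ hμ
    obtain ⟨v, hv⟩ := hμ.exists_hasEigenvector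
    have hTv : T (v : F) = μ • (v : F) := congrArg Subtype.val hv.apply_eq_smul
    have hv0 : (v : F) ≠ 0 := by simpa using hv.2
    have hvp : 0 < ‖(v : F)‖ := norm_pos_iff.2 hv0
    have hAv : ‖A v‖ ^ 2 = μ * ‖(v : F)‖ ^ 2 := by
      rw [← real_inner_self_eq_norm_sq, ← hT, hTv, real_inner_smul_left,
        real_inner_self_eq_norm_sq]
    have hμ0 : 0 ≤ μ := by
      by_contra! hneg
      nlinarith [sq_nonneg ‖A v‖, mul_pos hvp hvp]
    rw [abs_of_nonneg hμ0]
    by_contra! hlt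
    apply hmax
    refine ⟨Fin.cons (‖(v : F)‖⁻¹ • (v : F)) e, Fin.cons μ l, ?_, ?_, ?_⟩
    · have hvU := (hU _).1 v.2
      constructor
      · intro i
        refine Fin.cases ?_ (fun i => ?_) i
        · simp [norm_smul, hvp.ne']
        · simpa using h.1.1 i
      · intro i j
        refine Fin.cases ?_ (fun i => ?_) i <;> refine Fin.cases ?_ (fun j => ?_) j
        · simp
        · intro _
          simp only [Fin.cons_zero, Fin.cons_succ]
          rw [real_inner_smul_left, real_inner_comm, hvU, mul_zero]
        · intro _
          simp [real_inner_smul_right, hvU]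
        · intro hij
          simpa using h.1.2 (fun h => hij (by rw [h]))
    · intro i f
      refine Fin.cases ?_ (fun i => ?_) i
      · simp only [Fin.cons_zero, map_smul, real_inner_smul_left]
        rw [← hT, hTv, real_inner_smul_left]
        ring
      · simpa using h.2.1 i f
    · intro i
      refine Fin.cases ?_ (fun i => ?_) i
      · simpa using hlt
      · simpa using h.2.2 i
  -- The norm of a self-adjoint operator is its spectral radius, and the nonzero spectrum of a
  -- compact operator consists of eigenvalues.
  have hSnorm : ‖S‖ ≤ s ^ 2 := by
    have h1 : spectralRadius ℝ S ≤ ENNReal.ofReal (s ^ 2) := by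
      refine iSup₂_le fun μ hμ => ?_
      change ‖μ‖ₑ ≤ _
      rw [← ofReal_norm, Real.norm_eq_abs]
      by_cases hμ0 : μ = 0
      · simp [hμ0]
      · exact ENNReal.ofReal_le_ofReal (hev μ ((hSc.hasEigenvalue_iff_mem_spectrum hμ0).2 hμ))
    rw [S.spectralRadius_eq_nnnorm hSs.isSelfAdjoint] at h1
    change ‖S‖ₑ ≤ _ at h1
    rwa [← ofReal_norm, ENNReal.ofReal_le_ofReal_iff (by positivity)] at h1
  intro g hg
  have h1 : ‖A g‖ ^ 2 = ⟪S ⟨g, (hU g).2 hg⟩, ⟨g, (hU g).2 hg⟩⟫_ℝ := by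
    rw [← real_inner_self_eq_norm_sq, ← hT]
    rfl
  have h2 : ‖A g‖ ^ 2 ≤ (s * ‖g‖) ^ 2 := by
    rw [h1, mul_pow]
    refine (real_inner_le_norm _ _).trans ?_
    have := S.le_opNorm ⟨g, (hU g).2 hg⟩
    have h3 : ‖(⟨g, (hU g).2 hg⟩ : U)‖ = ‖g‖ := rfl
    rw [h3] at this ⊢
    calc _ ≤ s ^ 2 * ‖g‖ * ‖g‖ := by gcongr; exact this.trans (by gcongr)
      _ = _ := by ring
  exact le_of_sq_le_sq h2 (by positivity)
end Spectral

/-! ### Second moments of collocation determinants -/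

/-- The collocation matrix of the functions `b` at the points `x`. -/
def collocation {X : Type*} {m : ℕ} (b : Fin m → X → ℝ) (x : Fin m → X) :
    Matrix (Fin m) (Fin m) ℝ :=
  Matrix.of fun i j => b i (x j)

section Determinant

variable {X : Type*} [MeasurableSpace X] {μ : Measure X} {m : ℕ}

open Equiv in
/-- Andréief's identity for an orthogonal system of functions. -/
lemma integral_det_sq [SigmaFinite μ] {φ : Fin m → X → ℝ} (hφ : ∀ i, MemLp (φ i) 2 μ)
    (horth : ∀ i j, i ≠ j → ∫ x, φ i x * φ j x ∂μ = 0) :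
    Integrable (fun x : Fin m → X => (collocation φ x).det ^ 2)
        (Measure.pi fun _ => μ) ∧
      ∫ x : Fin m → X, (collocation φ x).det ^ 2 ∂(Measure.pi fun _ => μ)
        = m.factorial * ∏ i, ∫ x, φ i x ^ 2 ∂μ := by
  have hexp : ∀ x : Fin m → X, (collocation φ x).det ^ 2
      = ∑ σ : Perm (Fin m), ∑ τ : Perm (Fin m), ((Perm.sign σ : ℤ) : ℝ) * ((Perm.sign τ : ℤ) : ℝ) *
          ∏ j, (φ (σ j) (x j) * φ (τ j) (x j)) := fun x => by
    rw [collocation, Matrix.det_apply', sq, Finset.sum_mul_sum]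
    refine Finset.sum_congr rfl fun σ _ => Finset.sum_congr rfl fun τ _ => ?_
    rw [Finset.prod_mul_distrib]
    simp only [Matrix.of_apply]
    ring
  have hint : ∀ σ τ : Perm (Fin m), Integrable (fun x : Fin m → X =>
      ((Perm.sign σ : ℤ) : ℝ) * ((Perm.sign τ : ℤ) : ℝ) *
          ∏ j, (φ (σ j) (x j) * φ (τ j) (x j))) (Measure.pi fun _ => μ) := fun σ τ =>
    (Integrable.fintype_prod (f := fun j x => φ (σ j) x * φ (τ j) x)
      fun j => (hφ (σ j)).integrable_mul (hφ (τ j))).const_mul _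
  simp_rw [hexp]
  refine ⟨integrable_finsetSum _ fun σ _ => integrable_finsetSum _ fun τ _ => hint σ τ, ?_⟩
  rw [integral_finsetSum _ fun σ _ => integrable_finsetSum _ fun τ _ => hint σ τ]
  -- Only `τ = σ` survives: otherwise some coordinate contributes the integral of two orthogonal
  -- functions. The `m!` diagonal terms all have the same value.
  have hterm : ∀ σ : Perm (Fin m), ∫ x : Fin m → X, ∑ τ : Perm (Fin m),
      ((Perm.sign σ : ℤ) : ℝ) * ((Perm.sign τ : ℤ) : ℝ) *
          ∏ j, (φ (σ j) (x j) * φ (τ j) (x j)) ∂(Measure.pi fun _ => μ)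
      = ∏ i, ∫ x, φ i x ^ 2 ∂μ := fun σ => by
    rw [integral_finsetSum _ fun τ _ => hint σ τ, Finset.sum_eq_single σ]
    · rw [integral_const_mul,
        integral_fintype_prod_eq_prod (μ := fun _ => μ) (fun j x => φ (σ j) x * φ (σ j) x)]
      have hs : ((Perm.sign σ : ℤ) : ℝ) * ((Perm.sign σ : ℤ) : ℝ) = 1 := by
        norm_cast
        rw [Int.units_mul_self]
        rfl
      rw [hs, one_mul]
      simp_rw [← sq]
      exact Equiv.prod_comp σ fun i => ∫ x, φ i x ^ 2 ∂μ
    · intro τ _ hτ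
      rw [integral_const_mul,
        integral_fintype_prod_eq_prod (μ := fun _ => μ) (fun j x => φ (σ j) x * φ (τ j) x)]
      obtain ⟨j, hj⟩ : ∃ j, σ j ≠ τ j := by
        by_contra! hall
        exact hτ (Equiv.ext fun j => (hall j).symm)
      rw [Finset.prod_eq_zero (Finset.mem_univ j) (horth _ _ hj), mul_zero]
    · simp
  rw [Finset.sum_congr rfl fun σ _ => hterm σ]
  simp [Fintype.card_perm]

end Determinant

/-! ### Interpolation at determinantally distributed points -/

/-- A finite orthonormal system of measurable functions in `L₂(μ)`. -/
structure IsOrthonormalSystem {X : Type*} [MeasurableSpace X] (μ : Measure X) {m : ℕ}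
    (b : Fin m → X → ℝ) : Prop where
  measurable : ∀ i, Measurable (b i)
  memLp : ∀ i, MemLp (b i) 2 μ
  integral_mul : ∀ i j, ∫ x, b i x * b j x ∂μ = if i = j then 1 else 0

/-- A randomized method that recovers the coefficients `c` of a function `∑ c_i b_i + g`, where `g`
is orthogonal to the orthonormal system `b`, from values at `N` random points. The mean
square error of the coefficients is at most `B ‖g‖²`. -/
structure Estimator {X : Type} [MeasurableSpace X] (μ : Measure X) {m : ℕ} (b : Fin m → X → ℝ)
    (N : ℕ) (B : ℝ) where
  Ω : Type
  [measurableSpace : MeasurableSpace Ω]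
  prob : Measure Ω
  [isProbabilityMeasure : IsProbabilityMeasure prob]
  node : Ω → Fin N → X
  measurable_node : Measurable node
  map_node_ac : ∀ j, prob.map (fun ω => node ω j) ≪ μ
  coef : Ω → (Fin N → ℝ) → Fin m → ℝ
  measurable_coef : Measurable fun p : Ω × (Fin N → ℝ) => coef p.1 p.2
  bound : ∀ (c : Fin m → ℝ) (g : X → ℝ), Measurable g → MemLp g 2 μ →
    (∀ i, ∫ x, b i x * g x ∂μ = 0) →
    ∫⁻ ω, ENNReal.ofReal
      (∑ i, (coef ω (fun j => ∑ k, c k * b k (node ω j) + g (node ω j)) i - c i) ^ 2) ∂prob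
      ≤ ENNReal.ofReal (B * ∫ x, g x ^ 2 ∂μ)

attribute [instance] Estimator.measurableSpace Estimator.isProbabilityMeasure

section Interpolation

variable {X : Type} [MeasurableSpace X] {μ : Measure X} {m : ℕ} {b : Fin m → X → ℝ}

lemma measurable_det {Y : Type*} [MeasurableSpace Y] {M : Y → Matrix (Fin m) (Fin m) ℝ}
    (hM : ∀ i j, Measurable fun y => M y i j) : Measurable fun y => (M y).det := by
  simp_rw [Matrix.det_apply']
  exact Finset.measurable_sum _ fun σ _ =>
    (Finset.measurable_prod _ fun i _ => hM _ _).const_mul _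

lemma measurable_det_collocation (hb : ∀ i, Measurable (b i)) :
    Measurable fun x => (collocation b x).det :=
  measurable_det fun i j => (hb i).comp (measurable_pi_apply j)

/-- The determinant is linear in row `i`, and Cramer's rule evaluates the part coming from the span
of `b`. After division by the determinant, the error of coefficient `i` is a quotient whose
denominator cancels against the sampling density. -/
lemma det_updateRow_collocation {X : Type*} {m : ℕ} {b : Fin m → X → ℝ} (x : Fin m → X)
    (i : Fin m) (c : Fin m → ℝ) (g : X → ℝ) :
    ((collocation b x).updateRow i fun j => ∑ k, c k * b k (x j) + g (x j)).det
      = (collocation b x).det * c i + (collocation (Function.update b i g) x).det := by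
  have h1 : (fun j => ∑ k, c k * b k (x j) + g (x j))
      = (collocation b x).transpose.mulVec c + fun j => g (x j) := by
    funext j
    simp [Matrix.mulVec, dotProduct, collocation, mul_comm]
  have h2 : (collocation b x).updateRow i (fun j => g (x j))
      = collocation (Function.update b i g) x := by
    ext k j
    by_cases hk : k = i
    · subst hk; simp [collocation]
    · simp [collocation, hk]
  rw [h1, Matrix.det_updateRow_add, h2, ← Matrix.cramer_transpose_apply,
    Matrix.cramer_eq_adjugate_mulVec, Matrix.mulVec_mulVec, Matrix.adjugate_mul,
    Matrix.smul_mulVec, Matrix.one_mulVec, Matrix.det_transpose]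
  rfl

/-- Replacing `b i` by `g` keeps the system orthogonal, so `integral_det_sq` applies; the only
factor different from `1` is `∫ g²`. -/
lemma lintegral_det_collocation_update [IsProbabilityMeasure μ] (hb : IsOrthonormalSystem μ b)
    (i : Fin m) {g : X → ℝ} (hg : MemLp g 2 μ) (hbg : ∀ i, ∫ x, b i x * g x ∂μ = 0) :
    ∫⁻ x, ENNReal.ofReal ((collocation (Function.update b i g) x).det ^ 2)
        ∂(Measure.pi fun _ => μ) = ENNReal.ofReal (m.factorial * ∫ x, g x ^ 2 ∂μ) := by
  have h := integral_det_sq (μ := μ) (φ := Function.update b i g) (fun k => by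
      by_cases hk : k = i
      · subst hk; simpa using hg
      · simpa [hk] using hb.memLp k) (fun k l hkl => by
      by_cases hk : k = i
      · subst hk
        simp only [Function.update_self, Function.update_of_ne hkl.symm]
        simpa [mul_comm] using hbg l
      · by_cases hl : l = i
        · subst hl
          simpa [hk] using hbg k
        · simpa [hk, hl, hkl] using hb.integral_mul k l)
  rw [← ofReal_integral_eq_lintegral_ofReal h.1 (ae_of_all _ fun x => sq_nonneg _)]
  congr 1
  refine h.2.trans ?_
  rw [Finset.prod_eq_single i]
  · simp
  · intro k _ hk
    simpa [hk, sq] using hb.integral_mul k k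
  · simp

lemma lintegral_det_collocation [IsProbabilityMeasure μ] (hb : IsOrthonormalSystem μ b) :
    ∫⁻ x, ENNReal.ofReal ((collocation b x).det ^ 2)
        ∂(Measure.pi fun _ => μ) = ENNReal.ofReal m.factorial := by
  have h := integral_det_sq (μ := μ) (φ := b) hb.memLp fun k l hkl => by
    simpa [hkl] using hb.integral_mul k l
  rw [← ofReal_integral_eq_lintegral_ofReal h.1 (ae_of_all _ fun x => sq_nonneg _)]
  congr 1
  refine h.2.trans ?_
  rw [Finset.prod_eq_one fun k _ => ?_, mul_one]
  simpa [sq] using hb.integral_mul k k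

/-- Interpolation at random points that are distributed according to the squared determinant of
the collocation matrix. -/
noncomputable def Estimator.interpolation [IsProbabilityMeasure μ] (hb : IsOrthonormalSystem μ b) :
    Estimator μ b m m where
  Ω := Fin m → X
  prob := (Measure.pi fun _ => μ).withDensity fun x =>
    ENNReal.ofReal (m.factorial)⁻¹ * ENNReal.ofReal ((collocation b x).det ^ 2)
  isProbabilityMeasure := ⟨by
    rw [withDensity_apply _ MeasurableSet.univ, Measure.restrict_univ, lintegral_const_mul,
      lintegral_det_collocation hb, ← ENNReal.ofReal_mul (by positivity),
      inv_mul_cancel₀ (by positivity), ENNReal.ofReal_one]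
    exact ((measurable_det_collocation hb.measurable).pow_const 2).ennreal_ofReal⟩
  node := fun x => x
  measurable_node := measurable_id
  map_node_ac := fun j =>
    ((withDensity_absolutelyContinuous _ _).map (measurable_pi_apply j)).trans
      (Measure.quasiMeasurePreserving_eval (fun _ => μ) j).absolutelyContinuous
  coef := fun x y i => ((collocation b x).updateRow i y).det / (collocation b x).det
  measurable_coef := by
    refine measurable_pi_lambda _ fun i => Measurable.div ?_ ?_
    · refine measurable_det fun k j => ?_
      by_cases hk : k = i
      · subst hk
        simp only [Matrix.updateRow_self]
        exact (measurable_pi_apply j).comp measurable_snd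
      · simp only [Matrix.updateRow_ne hk]
        exact (hb.measurable k).comp ((measurable_pi_apply j).comp measurable_fst)
    · exact (measurable_det_collocation hb.measurable).comp measurable_fst
  bound := fun c g hgm hg hbg => by
    have hdm := measurable_det_collocation hb.measurable
    have hum : ∀ i, Measurable fun x => (collocation (Function.update b i g) x).det := fun i =>
      measurable_det_collocation fun k => by
        by_cases hk : k = i
        · subst hk; simpa using hgm
        · simpa [hk] using hb.measurable k
    simp_rw [det_updateRow_collocation]
    have hden : Measurable fun x => ENNReal.ofReal (m.factorial)⁻¹ *
        ENNReal.ofReal ((collocation b x).det ^ 2) :=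
      (hdm.pow_const 2).ennreal_ofReal.const_mul _
    have herr : Measurable fun x => ENNReal.ofReal (∑ i, (((collocation b x).det * c i +
        (collocation (Function.update b i g) x).det) / (collocation b x).det - c i) ^ 2) := by
      fun_prop
    rw [lintegral_withDensity_eq_lintegral_mul _ hden herr]
    calc _ ≤ ∫⁻ x, ENNReal.ofReal (m.factorial)⁻¹ * ∑ i, ENNReal.ofReal
            ((collocation (Function.update b i g) x).det ^ 2) ∂(Measure.pi fun _ => μ) := by
          refine lintegral_mono fun x => ?_
          simp only [Pi.mul_apply]
          rw [mul_assoc, ← ENNReal.ofReal_mul (by positivity),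
            ← ENNReal.ofReal_sum_of_nonneg fun i _ => by positivity]
          gcongr
          rw [Finset.mul_sum]
          refine Finset.sum_le_sum fun i _ => ?_
          -- Where the determinant vanishes, so does the density, and the default value of the
          -- quotient is harmless.
          by_cases h0 : (collocation b x).det = 0
          · simp only [h0]
            nlinarith [sq_nonneg (collocation (Function.update b i g) x).det]
          · rw [← mul_pow]
            refine le_of_eq (congrArg (· ^ 2) ?_)
            field_simp
            ring
      _ = ENNReal.ofReal (m * ∫ x, g x ^ 2 ∂μ) := by
          rw [lintegral_const_mul _ (by fun_prop), lintegral_finsetSum _ (by fun_prop)]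
          simp_rw [lintegral_det_collocation_update hb _ hg hbg]
          rw [Finset.sum_const, Finset.card_univ, Fintype.card_fin, nsmul_eq_mul,
            ← ENNReal.ofReal_natCast, ← ENNReal.ofReal_mul (by positivity),
            ← ENNReal.ofReal_mul (by positivity)]
          congr 1
          field_simp

end Interpolation

/-! ### Stochastic gradient descent with Christoffel sampling -/

section Descent

variable {X : Type} [MeasurableSpace X] {μ : Measure X} {m : ℕ} {b : Fin m → X → ℝ}

/-- The normalised Christoffel function of an orthonormal system. -/
noncomputable def christoffel (b : Fin m → X → ℝ) (x : X) : ℝ := (m : ℝ)⁻¹ * ∑ i, b i x ^ 2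

lemma christoffel_nonneg {X : Type} {m : ℕ} (b : Fin m → X → ℝ) (x : X) : 0 ≤ christoffel b x := by
  unfold christoffel; positivity

lemma IsOrthonormalSystem.measurable_christoffel (hb : IsOrthonormalSystem μ b) :
    Measurable (christoffel b) := by
  have := hb.measurable
  unfold christoffel
  fun_prop

lemma IsOrthonormalSystem.integrable_christoffel (hb : IsOrthonormalSystem μ b) :
    Integrable (christoffel b) μ :=
  (integrable_finsetSum _ fun i _ => (hb.memLp i).integrable_sq).const_mul _

lemma IsOrthonormalSystem.integral_christoffel (hb : IsOrthonormalSystem μ b) (hm : m ≠ 0) :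
    ∫ x, christoffel b x ∂μ = 1 := by
  unfold christoffel
  rw [integral_const_mul, integral_finsetSum _ fun i _ => (hb.memLp i).integrable_sq]
  simp_rw [sq, hb.integral_mul]
  simp [hm]

/-- The law with density given by the Christoffel function. -/
noncomputable def christoffelLaw (μ : Measure X) (b : Fin m → X → ℝ) : Measure X :=
  μ.withDensity fun x => ENNReal.ofReal (christoffel b x)

lemma IsOrthonormalSystem.isProbabilityMeasure_christoffelLaw (hb : IsOrthonormalSystem μ b)
    (hm : m ≠ 0) : IsProbabilityMeasure (christoffelLaw μ b) := ⟨by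
  rw [christoffelLaw, withDensity_apply _ MeasurableSet.univ, Measure.restrict_univ,
    ← ofReal_integral_eq_lintegral_ofReal hb.integrable_christoffel
      (ae_of_all _ fun x => christoffel_nonneg b x), hb.integral_christoffel hm, ENNReal.ofReal_one]⟩

lemma integrable_fun_mul {f g : X → ℝ} (hf : MemLp f 2 μ) (hg : MemLp g 2 μ) :
    Integrable (fun x => f x * g x) μ := hf.integrable_mul hg

/-- Integrals of products of functions `∑ d_i b_i + g`. -/
lemma IsOrthonormalSystem.integral_residual (hb : IsOrthonormalSystem μ b) {g : X → ℝ}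
    (hg : MemLp g 2 μ) (hbg : ∀ i, ∫ x, b i x * g x ∂μ = 0) (d : Fin m → ℝ) :
    ∫ x, (∑ k, d k * b k x + g x) * ∑ i, d i * b i x ∂μ = ∑ i, d i ^ 2 ∧
    ∫ x, (∑ k, d k * b k x + g x) ^ 2 ∂μ = ∑ i, d i ^ 2 + ∫ x, g x ^ 2 ∂μ := by
  have hw : MemLp (fun x => ∑ i, d i * b i x) 2 μ :=
    memLp_finsetSum _ fun i _ => (hb.memLp i).const_mul _
  have h1 : ∫ x, (∑ k, d k * b k x) * ∑ i, d i * b i x ∂μ = ∑ i, d i ^ 2 := by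
    simp_rw [Finset.sum_mul_sum]
    rw [integral_finsetSum _ fun i _ => integrable_finsetSum _ fun j _ =>
      integrable_fun_mul ((hb.memLp i).const_mul _) ((hb.memLp j).const_mul _)]
    refine Finset.sum_congr rfl fun i _ => ?_
    rw [integral_finsetSum _ fun j _ =>
      integrable_fun_mul ((hb.memLp i).const_mul _) ((hb.memLp j).const_mul _)]
    have : ∀ j, ∫ x, d i * b i x * (d j * b j x) ∂μ = d i * d j * if i = j then 1 else 0 :=
      fun j => by
        rw [← hb.integral_mul, ← integral_const_mul]
        exact integral_congr_ae (ae_of_all _ fun x => by ring)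
    simp_rw [this]
    simp [sq]
  have h2 : ∫ x, g x * ∑ i, d i * b i x ∂μ = 0 := by
    simp_rw [Finset.mul_sum]
    rw [integral_finsetSum _ fun i _ => integrable_fun_mul hg ((hb.memLp i).const_mul _)]
    refine Finset.sum_eq_zero fun i _ => ?_
    have : ∫ x, g x * (d i * b i x) ∂μ = d i * ∫ x, b i x * g x ∂μ := by
      rw [← integral_const_mul]
      exact integral_congr_ae (ae_of_all _ fun x => by ring)
    rw [this, hbg, mul_zero]
  constructor
  · simp_rw [add_mul]
    rw [integral_add (integrable_fun_mul hw hw) (integrable_fun_mul hg hw), h1, h2, add_zero]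
  · have : ∀ x, (∑ k, d k * b k x + g x) ^ 2 = (∑ k, d k * b k x) * (∑ i, d i * b i x) +
        (2 * (g x * ∑ i, d i * b i x) + g x ^ 2) := fun x => by ring
    simp_rw [this]
    have hgw := (integrable_fun_mul hg hw).const_mul 2
    have hgg : Integrable (fun x => 2 * (g x * ∑ i, d i * b i x) + g x ^ 2) μ :=
      hgw.add hg.integrable_sq
    rw [integral_add (integrable_fun_mul hw hw) hgg, integral_add hgw hg.integrable_sq,
      integral_const_mul, h1, h2]
    ring

/-- One step of stochastic gradient descent with step size `θ / m`. -/
lemma IsOrthonormalSystem.lintegral_descent (hb : IsOrthonormalSystem μ b) (hm : m ≠ 0) {θ : ℝ}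
    (hθ : 0 ≤ θ) (hθ1 : θ ≤ 1) {g : X → ℝ} (hgm : Measurable g) (hg : MemLp g 2 μ)
    (hbg : ∀ i, ∫ x, b i x * g x ∂μ = 0) (d : Fin m → ℝ) :
    ∫⁻ x, ENNReal.ofReal (∑ i, (θ / m * ((∑ k, d k * b k x + g x) * b i x / christoffel b x)
        - d i) ^ 2) ∂(christoffelLaw μ b)
      ≤ ENNReal.ofReal ((1 - θ / m) * ∑ i, d i ^ 2 + θ ^ 2 / m * ∫ x, g x ^ 2 ∂μ) := by
  have hm0 : (0 : ℝ) < m := by positivity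
  have hw : MemLp (fun x => ∑ i, d i * b i x) 2 μ :=
    memLp_finsetSum _ fun i _ => (hb.memLp i).const_mul _
  have hh : MemLp (fun x => ∑ i, d i * b i x + g x) 2 μ := hw.add hg
  -- The expanded square times the Christoffel density. This density is chosen because `∑ b_i² = m *
  -- christoffel b` turns the quadratic term into a multiple of the squared residual, free of any
  -- denominator.
  let H : X → ℝ := fun x => christoffel b x * ∑ i, d i ^ 2
    - 2 * (θ / m) * ((∑ k, d k * b k x + g x) * ∑ i, d i * b i x)
    + θ ^ 2 / m * (∑ k, d k * b k x + g x) ^ 2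
  have hHint : Integrable H μ := ((hb.integrable_christoffel.mul_const _).sub
    ((hh.integrable_mul hw).const_mul _)).add (hh.integrable_sq.const_mul _)
  have hHval : ∫ x, H x ∂μ = (1 - 2 * (θ / m) + θ ^ 2 / m) * ∑ i, d i ^ 2
      + θ ^ 2 / m * ∫ x, g x ^ 2 ∂μ := by
    obtain ⟨h1, h2⟩ := hb.integral_residual hg hbg d
    have hhw : Integrable (fun x => 2 * (θ / m) *
        ((∑ k, d k * b k x + g x) * ∑ i, d i * b i x)) μ :=
      (integrable_fun_mul hh hw).const_mul _
    have hsub : Integrable (fun x => christoffel b x * ∑ i, d i ^ 2 -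
        2 * (θ / m) * ((∑ k, d k * b k x + g x) * ∑ i, d i * b i x)) μ :=
      (hb.integrable_christoffel.mul_const _).sub hhw
    rw [integral_add hsub (hh.integrable_sq.const_mul _),
      integral_sub (hb.integrable_christoffel.mul_const _) hhw,
      integral_mul_const, integral_const_mul, integral_const_mul, h1, h2,
      hb.integral_christoffel hm]
    ring
  -- Equality holds where the density is positive. Where it is zero all `b i` vanish, and only a
  -- nonnegative term of `H` remains.
  have hpt : ∀ x, christoffel b x * ∑ i, (θ / m * ((∑ k, d k * b k x + g x) * b i x /
      christoffel b x) - d i) ^ 2 ≤ H x := fun x => by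
    simp only [H]
    generalize (∑ k, d k * b k x + g x) = h
    rcases (christoffel_nonneg b x).eq_or_lt with h0 | hpos
    · have hsum : ∑ i, b i x ^ 2 = 0 := by
        have := h0.symm
        unfold christoffel at this
        simpa [hm] using this
      have hb0 : ∀ i, b i x = 0 := fun i => by
        have := (Finset.sum_eq_zero_iff_of_nonneg fun i _ => sq_nonneg (b i x)).1 hsum i
          (Finset.mem_univ i)
        simpa using this
      rw [← h0]
      simp [hb0]
      positivity
    · have hsum : ∑ i, b i x ^ 2 = m * christoffel b x := by
        unfold christoffel
        field_simp
      have : ∀ i, (θ / m * (h * b i x / christoffel b x) - d i) ^ 2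
          = (θ / m * h / christoffel b x) ^ 2 * b i x ^ 2
            - 2 * (θ / m * h / christoffel b x) * (d i * b i x) + d i ^ 2 := fun i => by
        field_simp
        ring
      simp_rw [this]
      rw [Finset.sum_add_distrib, Finset.sum_sub_distrib, ← Finset.mul_sum, ← Finset.mul_sum, hsum]
      refine le_of_eq ?_
      field_simp
      ring
  have hum := hb.measurable_christoffel
  have hbm := hb.measurable
  rw [christoffelLaw, lintegral_withDensity_eq_lintegral_mul _ (by fun_prop) (by fun_prop)]
  calc _ ≤ ∫⁻ x, ENNReal.ofReal (H x) ∂μ := by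
        refine lintegral_mono fun x => ?_
        simp only [Pi.mul_apply]
        rw [← ENNReal.ofReal_mul (christoffel_nonneg b x)]
        exact ENNReal.ofReal_le_ofReal (hpt x)
    _ = ENNReal.ofReal (∫ x, H x ∂μ) := by
        refine (ofReal_integral_eq_lintegral_ofReal hHint (ae_of_all _ fun x => ?_)).symm
        exact le_trans (mul_nonneg (christoffel_nonneg b x)
          (Finset.sum_nonneg fun i _ => sq_nonneg _)) (hpt x)
    _ ≤ _ := by
        rw [hHval]
        apply ENNReal.ofReal_le_ofReal
        -- Since `θ ≤ 1`, the factor `1 - 2θ/m + θ²/m` is at most `1 - θ/m`.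
        have : θ ^ 2 / m ≤ θ / m := by gcongr; nlinarith
        have h2 : 0 ≤ ∑ i, d i ^ 2 := by positivity
        nlinarith

/-- Improving an estimator by one additional random point. -/
noncomputable def Estimator.descent (hb : IsOrthonormalSystem μ b) (hm : m ≠ 0) {θ : ℝ}
    (hθ : 0 ≤ θ) (hθ1 : θ ≤ 1) {N : ℕ} {B : ℝ} (hB : 0 ≤ B) (E : Estimator μ b N B) :
    Estimator μ b (N + 1) ((1 - θ / m) * B + θ ^ 2 / m) where
  Ω := E.Ω × X
  prob := E.prob.prod (christoffelLaw μ b)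
  isProbabilityMeasure := by
    have := hb.isProbabilityMeasure_christoffelLaw hm
    infer_instance
  node := fun p => Fin.snoc (E.node p.1) p.2
  measurable_node := by
    refine measurable_pi_lambda _ fun j => ?_
    refine Fin.lastCases ?_ (fun j => ?_) j
    · simpa using measurable_snd
    · simp only [Fin.snoc_castSucc]
      exact (measurable_pi_apply j).comp (E.measurable_node.comp measurable_fst)
  map_node_ac := fun j => by
    have := hb.isProbabilityMeasure_christoffelLaw hm
    refine Fin.lastCases ?_ (fun j => ?_) j
    · simp only [Fin.snoc_last]
      change (Measure.map Prod.snd _) ≪ μ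
      rw [Measure.map_snd_prod]
      simpa using! withDensity_absolutelyContinuous _ _
    · simp only [Fin.snoc_castSucc]
      change Measure.map ((fun ω => E.node ω j) ∘ Prod.fst) _ ≪ μ
      rw [← Measure.map_map (g := fun ω => E.node ω j) (f := Prod.fst)
        ((measurable_pi_apply j).comp E.measurable_node) measurable_fst, Measure.map_fst_prod]
      simpa using E.map_node_ac j
  -- The bracket is the residual of the current estimate at the new node; division by the
  -- Christoffel function makes the gradient step unbiased.
  coef := fun p y i => E.coef p.1 (Fin.init y) i + θ / m *
    ((y (Fin.last N) - ∑ k, E.coef p.1 (Fin.init y) k * b k p.2) * b i p.2 / christoffel b p.2)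
  measurable_coef := by
    have hum := hb.measurable_christoffel
    have hbm := hb.measurable
    have hc : Measurable fun p : (E.Ω × X) × (Fin (N + 1) → ℝ) => E.coef p.1.1 (Fin.init p.2) :=
      E.measurable_coef.comp ((measurable_fst.comp measurable_fst).prodMk
        (measurable_pi_lambda _ fun j => (measurable_pi_apply j.castSucc).comp measurable_snd))
    have hci : ∀ i, Measurable fun p : (E.Ω × X) × (Fin (N + 1) → ℝ) =>
        E.coef p.1.1 (Fin.init p.2) i := fun i => (measurable_pi_apply i).comp hc
    refine measurable_pi_lambda _ fun i => ?_
    fun_prop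
  bound := fun c g hgm hg hbg => by
    have := hb.isProbabilityMeasure_christoffelLaw hm
    have hm0 : (0 : ℝ) < m := by positivity
    have hm1 : (1 : ℝ) ≤ m := by exact_mod_cast Nat.one_le_iff_ne_zero.2 hm
    have hfac : 0 ≤ 1 - θ / m := by
      rw [sub_nonneg, div_le_one hm0]
      linarith
    have hum := hb.measurable_christoffel
    have hbm := hb.measurable
    let a : E.Ω → Fin m → ℝ := fun ω => E.coef ω fun j => ∑ k, c k * b k (E.node ω j) +
      g (E.node ω j)
    have ham : Measurable a := by
      refine E.measurable_coef.comp (measurable_id.prodMk (measurable_pi_lambda _ fun j => ?_))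
      have hn : Measurable fun ω => E.node ω j := (measurable_pi_apply j).comp E.measurable_node
      fun_prop
    have hai : ∀ i, Measurable fun ω => a ω i := fun i => (measurable_pi_apply i).comp ham
    have hstep : ∀ (p : E.Ω × X) i, (E.coef p.1 (Fin.init fun j => ∑ k, c k * b k
          ((Fin.snoc (E.node p.1) p.2 : Fin (N + 1) → X) j) +
          g ((Fin.snoc (E.node p.1) p.2 : Fin (N + 1) → X) j)) i) = a p.1 i := fun p i => by
      simp only [a]
      congr 1
      funext j
      simp [Fin.init]
    simp_rw [hstep, Fin.snoc_last]
    rw [lintegral_prod _ (by fun_prop)]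
    calc _ ≤ ∫⁻ ω, (ENNReal.ofReal (1 - θ / m) * ENNReal.ofReal (∑ i, (a ω i - c i) ^ 2)
            + ENNReal.ofReal (θ ^ 2 / m * ∫ x, g x ^ 2 ∂μ)) ∂E.prob := by
          refine lintegral_mono fun ω => ?_
          rw [← ENNReal.ofReal_mul hfac, ← ENNReal.ofReal_add (by positivity) (by positivity)]
          -- For fixed old nodes, the residual at the new node is that of the coefficient error `c -
          -- a`, so the one-step bound applies with `d = c - a`.
          have h := hb.lintegral_descent hm hθ hθ1 hgm hg hbg fun i => c i - a ω i
          have hsq : ∀ i, (c i - a ω i) ^ 2 = (a ω i - c i) ^ 2 := fun i => by ring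
          simp_rw [hsq] at h
          refine le_trans (le_of_eq (lintegral_congr fun x => ?_)) h
          congr 1
          refine Finset.sum_congr rfl fun i _ => ?_
          have : ∑ k, (c k - a ω k) * b k x = ∑ k, c k * b k x - ∑ k, a ω k * b k x := by
            rw [← Finset.sum_sub_distrib]
            exact Finset.sum_congr rfl fun k _ => by ring
          rw [this]
          ring
      _ ≤ ENNReal.ofReal (1 - θ / m) * ENNReal.ofReal (B * ∫ x, g x ^ 2 ∂μ)
            + ENNReal.ofReal (θ ^ 2 / m * ∫ x, g x ^ 2 ∂μ) := by
          rw [lintegral_add_right _ measurable_const, lintegral_const, measure_univ, mul_one,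
            lintegral_const_mul _ (by fun_prop)]
          gcongr
          exact E.bound c g hgm hg hbg
      _ = _ := by
          rw [← ENNReal.ofReal_mul hfac, ← ENNReal.ofReal_add (by positivity) (by positivity)]
          congr 1
          ring

/-- Weakening the error bound. -/
def Estimator.mono {N : ℕ} {B B' : ℝ} (h : B ≤ B') (E : Estimator μ b N B) :
    Estimator μ b N B' :=
  { E with
    bound := fun c g hgm hg hbg => (E.bound c g hgm hg hbg).trans
      (ENNReal.ofReal_le_ofReal (by gcongr)) }

/-- The error bound after `T` steps. -/
lemma exists_estimator [IsProbabilityMeasure μ] (hb : IsOrthonormalSystem μ b) (hm : m ≠ 0) {θ : ℝ}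
    (hθ : 0 ≤ θ) (hθ1 : θ ≤ 1) (T : ℕ) :
    Nonempty (Estimator μ b (m + T) ((1 - θ / m) ^ T * m + θ)) := by
  have hm0 : (0 : ℝ) < m := by positivity
  have hfac : 0 ≤ 1 - θ / m := by
    have : (1 : ℝ) ≤ m := by exact_mod_cast Nat.one_le_iff_ne_zero.2 hm
    rw [sub_nonneg, div_le_one hm0]
    linarith
  -- The recursion `B ↦ (1 - θ/m) B + θ²/m` has the fixed point `θ`; interpolation supplies the
  -- initial value `m`.
  induction T with
  | zero => exact ⟨(Estimator.interpolation hb).mono (by simpa using hθ)⟩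
  | succ T ih =>
    obtain ⟨E⟩ := ih
    refine ⟨(E.descent hb hm hθ hθ1 (by positivity)).mono (le_of_eq ?_)⟩
    ring

end Descent

/-! ### Singular vectors of the embedding as an orthonormal system of functions -/

section Embedding

variable {d : ℕ}

instance FunctionSpace.isProbabilityMeasure_density (P : FunctionSpace.{u} d) :
    IsProbabilityMeasure (density P.D P.ρ) := ⟨by
  rw [density, withDensity_apply _ MeasurableSet.univ, Measure.restrict_univ, P.lintegral_ρ]⟩

lemma FunctionSpace.inner_app (P : FunctionSpace.{u} d) (f g : P.F) :
    ⟪P.app f, P.app g⟫_ℝ = ∫ x, P.eval f x * P.eval g x ∂(density P.D P.ρ) := by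
  rw [L2.inner_def]
  refine integral_congr_ae ?_
  filter_upwards [(P.memLp_eval f).coeFn_toLp, (P.memLp_eval g).coeFn_toLp] with x hf hg
  change ⟪(MemLp.toLp (P.eval f) (P.memLp_eval f)) x, (MemLp.toLp (P.eval g) (P.memLp_eval g)) x⟫_ℝ
    = _
  rw [hf, hg]
  simp [mul_comm]

lemma FunctionSpace.norm_app_sq (P : FunctionSpace.{u} d) (f : P.F) :
    ‖P.app f‖ ^ 2 = ∫ x, P.eval f x ^ 2 ∂(density P.D P.ρ) := by
  rw [← real_inner_self_eq_norm_sq, P.inner_app]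
  simp_rw [sq]

/-- The embedding as a continuous linear map. -/
noncomputable def ApproxProblem.appL (P : ApproxProblem.{u} d) : P.F →L[ℝ] P.G :=
  ContinuousLinearMap.mkOfIsCompactOperator P.isCompact_app

@[simp] lemma ApproxProblem.appL_apply (P : ApproxProblem.{u} d) (f : P.F) :
    P.appL f = P.app f := rfl

lemma ApproxProblem.isCompactOperator_appL (P : ApproxProblem.{u} d) :
    IsCompactOperator P.appL := P.isCompact_app

variable {P : ApproxProblem.{u} d} {m : ℕ} {s : ℝ} {e : Fin m → P.F} {l : Fin m → ℝ}

/-- The eigenfunctions, normalised in `G`. -/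
noncomputable def eigenfunction (P : ApproxProblem.{u} d) (e : Fin m → P.F) (l : Fin m → ℝ)
    (i : Fin m) : P.D → ℝ := fun x => (Real.sqrt (l i))⁻¹ * P.eval (e i) x

lemma IsLargeEigenfamily.pos (h : IsLargeEigenfamily P.appL s e l) (i : Fin m) : 0 < l i :=
  (sq_nonneg s).trans_lt (h.2.2 i)

lemma IsLargeEigenfamily.isOrthonormalSystem (h : IsLargeEigenfamily P.appL s e l) :
    IsOrthonormalSystem (density P.D P.ρ) (eigenfunction P e l) where
  measurable i := (P.measurable_eval _).const_mul _
  memLp i := (P.memLp_eval _).const_mul _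
  integral_mul i j := by
    have : ∀ x, eigenfunction P e l i x * eigenfunction P e l j x
        = (Real.sqrt (l i))⁻¹ * (Real.sqrt (l j))⁻¹ * (P.eval (e i) x * P.eval (e j) x) :=
      fun x => by unfold eigenfunction; ring
    simp_rw [this]
    rw [integral_const_mul, ← P.inner_app]
    split_ifs with hij
    · subst hij
      have h1 := h.norm_sq i
      rw [P.appL_apply] at h1
      rw [real_inner_self_eq_norm_sq, h1, ← mul_inv, Real.mul_self_sqrt (h.pos i).le,
        inv_mul_cancel₀ (h.pos i).ne']
    · have h1 := h.inner_eq_zero hij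
      rw [P.appL_apply, P.appL_apply] at h1
      rw [h1, mul_zero]

/-- The decomposition of `f` into a combination of eigenfunctions and a remainder. -/
lemma IsLargeEigenfamily.decomposition (h : IsLargeEigenfamily P.appL s e l)
    (hs : ∀ g, (∀ i, ⟪e i, g⟫_ℝ = 0) → ‖P.appL g‖ ≤ s * ‖g‖) (hs0 : 0 ≤ s) (f : P.F) :
    ∃ (c : Fin m → ℝ) (g : P.F),
      (∀ x, P.eval f x = ∑ k, c k * eigenfunction P e l k x + P.eval g x) ∧
      (∀ i, ∫ x, eigenfunction P e l i x * P.eval g x ∂(density P.D P.ρ) = 0) ∧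
      ‖P.app g‖ ≤ s * ‖f‖ ∧
      ∀ a : Fin m → ℝ, ‖P.app f - ∑ i, a i • (Real.sqrt (l i))⁻¹ • P.app (e i)‖ ^ 2
        = ∑ i, (a i - c i) ^ 2 + ‖P.app g‖ ^ 2 := by
  have hsq : ∀ i, 0 < Real.sqrt (l i) := fun i => Real.sqrt_pos.2 (h.pos i)
  let g : P.F := f - ∑ i, ⟪e i, f⟫_ℝ • e i
  have hfg : f = ∑ i, ⟪e i, f⟫_ℝ • e i + g := by simp [g]
  have heg : ∀ i, ⟪e i, g⟫_ℝ = 0 := fun i => by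
    simp only [g, inner_sub_right]
    rw [h.1.inner_right_fintype, sub_self]
  -- For eigenvectors of `A† A`, orthogonality in `F` passes to `G`; hence Pythagoras is available
  -- in both spaces.
  have hAg : ∀ i, ⟪P.app (e i), P.app g⟫_ℝ = 0 := fun i => by
    have := h.2.1 i g
    rwa [P.appL_apply, P.appL_apply, heg, mul_zero] at this
  have hgf : ‖g‖ ≤ ‖f‖ := by
    have h0 : ⟪∑ i, ⟪e i, f⟫_ℝ • e i, g⟫_ℝ = 0 := by
      rw [sum_inner]
      exact Finset.sum_eq_zero fun i _ => by rw [real_inner_smul_left, heg, mul_zero]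
    have h1 := norm_add_sq_eq_norm_sq_add_norm_sq_real h0
    rw [← hfg] at h1
    nlinarith [norm_nonneg f, norm_nonneg g, norm_nonneg (∑ i, ⟪e i, f⟫_ℝ • e i)]
  refine ⟨fun i => Real.sqrt (l i) * ⟪e i, f⟫_ℝ, g, fun x => ?_, fun i => ?_, ?_, fun a => ?_⟩
  · conv_lhs => rw [hfg]
    simp only [map_add, map_sum, map_smul, Pi.add_apply, Finset.sum_apply, Pi.smul_apply,
      smul_eq_mul, eigenfunction]
    congr 1
    refine Finset.sum_congr rfl fun i _ => ?_
    field_simp [(hsq i).ne']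
  · unfold eigenfunction
    simp_rw [mul_assoc]
    rw [integral_const_mul, ← P.inner_app, hAg, mul_zero]
  · exact (hs g heg).trans (by gcongr)
  · have hdiff : P.app f - ∑ i, a i • (Real.sqrt (l i))⁻¹ • P.app (e i)
        = ∑ i, (Real.sqrt (l i) * ⟪e i, f⟫_ℝ - a i) • (Real.sqrt (l i))⁻¹ • P.app (e i)
          + P.app g := by
      conv_lhs => rw [hfg]
      simp only [map_add, map_sum, map_smul]
      rw [add_sub_right_comm, ← Finset.sum_sub_distrib]
      congr 1
      refine Finset.sum_congr rfl fun i _ => ?_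
      rw [sub_smul, smul_smul (Real.sqrt (l i) * _)]
      congr 2
      field_simp [(hsq i).ne']
    have hβ : Orthonormal ℝ fun i => (Real.sqrt (l i))⁻¹ • P.app (e i) := by
      constructor
      · intro i
        have h1 := h.norm_sq i
        rw [P.appL_apply] at h1
        rw [norm_smul, norm_inv, Real.norm_of_nonneg (hsq i).le, ← h1,
          Real.sqrt_sq (norm_nonneg _), inv_mul_cancel₀]
        intro h0
        rw [h0] at h1
        have := h.pos i
        simp at h1
        linarith
      · intro i j hij
        have h1 := h.inner_eq_zero hij
        rw [P.appL_apply, P.appL_apply] at h1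
        rw [real_inner_smul_left, real_inner_smul_right, h1]
        simp
    rw [hdiff]
    have h0 : ⟪∑ i, (Real.sqrt (l i) * ⟪e i, f⟫_ℝ - a i) • (Real.sqrt (l i))⁻¹ • P.app (e i),
        P.app g⟫_ℝ = 0 := by
      rw [sum_inner]
      exact Finset.sum_eq_zero fun i _ => by
        rw [real_inner_smul_left, real_inner_smul_left, hAg, mul_zero, mul_zero]
    have h1 := norm_add_sq_eq_norm_sq_add_norm_sq_real h0
    rw [sq, h1, ← sq, ← sq, ← real_inner_self_eq_norm_sq, hβ.inner_sum]
    congr 1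
    refine Finset.sum_congr rfl fun i _ => ?_
    simp
    ring

end Embedding

/-! ### From estimators to randomized algorithms -/

section Algorithm

variable {d : ℕ} {P : ApproxProblem.{u} d} {m : ℕ} {s : ℝ} {e : Fin m → P.F} {l : Fin m → ℝ}

/-- The function value at `x` as a linear functional. -/
def evalAt (P : ApproxProblem.{u} d) (x : P.D) : P.F →ₗ[ℝ] ℝ :=
  (LinearMap.proj x).comp P.eval

/-- The deterministic method that evaluates at the points `x` and returns `∑ a_i • β_i`, where the
coefficients `a` are computed from the function values. -/
noncomputable def samplingMethod (P : ApproxProblem.{u} d) {Λ : InfoClass}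
    (hΛ : Λ = .std ∨ Λ = .stdAE) {N : ℕ} (x : Fin (N + 1) → P.D)
    (a : (Fin (N + 1) → ℝ) → Fin m → ℝ) (ha : Measurable a) (β : Fin m → P.G) : Method P Λ where
  -- A method carries an infinite sequence of functionals. The nodes repeat cyclically, but only the
  -- first `N + 1` values are ever read; the output `0` for other `k` is never used.
  L j := evalAt P (x (Fin.ofNat (N + 1) j))
  L_mem j := by rcases hΛ with rfl | rfl <;> exact ⟨_, fun _ => rfl⟩
  halt k _ := k = N + 1
  φ k y := if h : k = N + 1 then ∑ i, a (fun j => y (j.cast h.symm)) i • β i else 0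
  φ_measurable k := by
    by_cases h : k = N + 1
    · subst h
      simp only [dif_pos, Fin.cast_eq_self]
      refine Finset.stronglyMeasurable_fun_sum _ fun i _ => ?_
      exact ((measurable_pi_apply i).comp ha).stronglyMeasurable.smul_const _
    · simp only [dif_neg h]
      exact stronglyMeasurable_const
  terminates f := ⟨N + 1, rfl⟩

section
variable {Λ : InfoClass} (hΛ : Λ = .std ∨ Λ = .stdAE) {N : ℕ} (x : Fin (N + 1) → P.D)
    (a : (Fin (N + 1) → ℝ) → Fin m → ℝ) (ha : Measurable a) (β : Fin m → P.G) (f : P.F)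

lemma samplingMethod_numInfo : (samplingMethod P hΛ x a ha β).numInfo f = N + 1 := by
  simp [Method.numInfo, samplingMethod]

lemma samplingMethod_run : (samplingMethod P hΛ x a ha β).run f
    = ∑ i, a (fun j => P.eval f (x j)) i • β i := by
  unfold Method.run
  rw [samplingMethod_numInfo]
  simp [samplingMethod, evalAt]
end

/-- The randomized algorithm given by an estimator. -/
noncomputable def Estimator.toRandAlg {Λ : InfoClass} (hΛ : Λ = .std ∨ Λ = .stdAE) {N : ℕ} {B : ℝ}
    {b : Fin m → P.D → ℝ} (E : Estimator (density P.D P.ρ) b (N + 1) B) (β : Fin m → P.G) :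
    RandAlg P Λ where
  Ω := E.Ω
  prob := E.prob
  method ω := samplingMethod P hΛ (E.node ω) (E.coef ω)
    (E.measurable_coef.comp measurable_prodMk_left) β
  measurable_run k v := by
    simp_rw [samplingMethod_run]
    refine Finset.stronglyMeasurable_fun_sum _ fun i _ => StronglyMeasurable.smul_const
      (Measurable.stronglyMeasurable ?_) _
    refine (measurable_pi_apply i).comp (E.measurable_coef.comp (measurable_snd.prodMk
      (measurable_pi_lambda _ fun j => ?_)))
    simp only [map_sum, map_smul, Finset.sum_apply, Pi.smul_apply, smul_eq_mul]
    refine Finset.measurable_sum _ fun i _ => ((measurable_pi_apply i).comp measurable_fst).mul ?_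
    exact (P.measurable_eval _).comp
      ((measurable_pi_apply j).comp (E.measurable_node.comp measurable_snd))
  measurable_numInfo k v := by
    simp_rw [samplingMethod_numInfo]
    exact measurable_const
  nodes_ae _ j := ⟨fun ω => E.node ω (Fin.ofNat (N + 1) j),
    (measurable_pi_apply _).comp E.measurable_node, E.map_node_ac _, fun _ _ => rfl⟩

/-- The minimal error of algorithms that use function values. -/
lemma IsLargeEigenfamily.minError_le (h : IsLargeEigenfamily P.appL s e l)
    (hs : ∀ g, (∀ i, ⟪e i, g⟫_ℝ = 0) → ‖P.appL g‖ ≤ s * ‖g‖) (hs0 : 0 ≤ s)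
    {Λ : InfoClass} (hΛ : Λ = .std ∨ Λ = .stdAE) {N : ℕ} (hN : N ≠ 0) {B : ℝ} (hB : 0 ≤ B)
    (E : Estimator (density P.D P.ρ) (eigenfunction P e l) N B) :
    minError P Λ N ≤ ENNReal.ofReal (Real.sqrt (B + 1) * s) := by
  obtain ⟨N, rfl⟩ := Nat.exists_eq_succ_of_ne_zero hN
  let A := E.toRandAlg hΛ fun i => (Real.sqrt (l i))⁻¹ • P.app (e i)
  have hcard : A.card ≤ ((N + 1 : ℕ) : ℝ≥0∞) := by
    refine iSup₂_le fun f _ => ?_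
    have : ∀ ω, ((A.method ω).numInfo f : ℝ≥0∞) = ((N + 1 : ℕ) : ℝ≥0∞) := fun ω => by
      congr 1
      exact samplingMethod_numInfo hΛ (E.node ω) (E.coef ω)
        (E.measurable_coef.comp measurable_prodMk_left) _ f
    simp_rw [this]
    simp
  refine (iInf₂_le A hcard).trans (iSup₂_le fun f hf => ?_)
  obtain ⟨c, g, hfg, hbg, hg, herr⟩ := h.decomposition hs hs0 f
  have hgs : ‖P.app g‖ ≤ s := hg.trans (by nlinarith)
  -- By Pythagoras in `G` the squared error is the coefficient error, in mean at most `B ‖g‖²`, plus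
  -- `‖g‖²`, where `‖g‖ ≤ s` in `G`.
  have hmain : ∫⁻ ω, ‖P.app f - (A.method ω).run f‖ₑ ^ 2 ∂A.prob
      ≤ ENNReal.ofReal ((B + 1) * s ^ 2) := by
    calc ∫⁻ ω, ‖P.app f - (A.method ω).run f‖ₑ ^ 2 ∂A.prob
        = ∫⁻ ω, (ENNReal.ofReal (∑ i, (E.coef ω (fun j => ∑ k, c k *
            eigenfunction P e l k (E.node ω j) + P.eval g (E.node ω j)) i - c i) ^ 2)
            + ENNReal.ofReal (‖P.app g‖ ^ 2)) ∂E.prob := by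
          refine lintegral_congr fun ω => ?_
          have hrun : (A.method ω).run f = _ := samplingMethod_run hΛ (E.node ω) (E.coef ω)
            (E.measurable_coef.comp measurable_prodMk_left) _ f
          rw [hrun, ← ofReal_norm, ← ENNReal.ofReal_pow (norm_nonneg _), herr,
            ENNReal.ofReal_add (by positivity) (by positivity)]
          simp_rw [hfg]
      _ ≤ ENNReal.ofReal (B * ∫ x, P.eval g x ^ 2 ∂(density P.D P.ρ))
          + ENNReal.ofReal (‖P.app g‖ ^ 2) := by
          rw [lintegral_add_right _ measurable_const, lintegral_const, measure_univ, mul_one]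
          gcongr
          exact E.bound c _ (P.measurable_eval g) (P.memLp_eval g) hbg
      _ ≤ _ := by
          rw [← P.norm_app_sq, ← ENNReal.ofReal_add (by positivity) (by positivity)]
          apply ENNReal.ofReal_le_ofReal
          have : ‖P.app g‖ ^ 2 ≤ s ^ 2 := by gcongr
          nlinarith
  calc _ ≤ (ENNReal.ofReal ((B + 1) * s ^ 2)) ^ (1 / 2 : ℝ) := by gcongr
    _ = _ := by
      rw [ENNReal.ofReal_rpow_of_nonneg (by positivity) (by positivity), ← Real.sqrt_eq_rpow,
        Real.sqrt_mul (by positivity), Real.sqrt_sq hs0]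

end Algorithm

/-! ### Second moments of the uniform distribution on the sphere -/

section Sphere

variable {m : ℕ}

/-- The uniform distribution on the unit sphere, as the law of a normalised uniformly distributed
point of the unit ball. -/
noncomputable def sphereLaw (m : ℕ) : Measure (EuclideanSpace ℝ (Fin m)) :=
  (ProbabilityTheory.cond volume (Metric.ball (0 : EuclideanSpace ℝ (Fin m)) 1)).map
    fun x => ‖x‖⁻¹ • x

lemma measurable_normalize : Measurable fun x : EuclideanSpace ℝ (Fin m) => ‖x‖⁻¹ • x :=
  measurable_norm.inv.smul measurable_id

instance isProbabilityMeasure_sphereLaw : IsProbabilityMeasure (sphereLaw m) := by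
  have : IsProbabilityMeasure
      (ProbabilityTheory.cond volume (Metric.ball (0 : EuclideanSpace ℝ (Fin m)) 1)) :=
    ProbabilityTheory.cond_isProbabilityMeasure_of_finite
      (Metric.measure_ball_pos _ _ one_pos).ne' measure_ball_lt_top.ne
  exact Measure.isProbabilityMeasure_map measurable_normalize.aemeasurable

lemma ae_norm_eq_one_sphereLaw (hm : m ≠ 0) : ∀ᵐ x ∂(sphereLaw m), ‖x‖ = 1 := by
  rw [sphereLaw, ae_map_iff measurable_normalize.aemeasurable
    (measurableSet_eq_fun measurable_norm measurable_const)]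
  have : Nonempty (Fin m) := ⟨⟨0, Nat.pos_of_ne_zero hm⟩⟩
  have h0 : ∀ᵐ x : EuclideanSpace ℝ (Fin m), x ≠ 0 := by
    simp [ae_iff]
  have h1 := (ProbabilityTheory.cond_absolutelyContinuous (μ := volume)
    (s := Metric.ball (0 : EuclideanSpace ℝ (Fin m)) 1)).ae_le h0
  filter_upwards [h1] with x hx
  rw [norm_smul, norm_inv, norm_norm, inv_mul_cancel₀ (norm_ne_zero_iff.2 hx)]

/-- A linear isometry preserves the volume and the ball and commutes with normalisation. -/
lemma measurePreserving_sphereLaw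
    (R : EuclideanSpace ℝ (Fin m) ≃ₗᵢ[ℝ] EuclideanSpace ℝ (Fin m)) :
    MeasurePreserving R (sphereLaw m) (sphereLaw m) := by
  have hR : Measurable R := R.continuous.measurable
  refine ⟨hR, ?_⟩
  rw [sphereLaw, Measure.map_map hR measurable_normalize]
  have hcomm : (R ∘ fun x => ‖x‖⁻¹ • x) = (fun x => ‖x‖⁻¹ • x) ∘ R := by
    funext x
    simp
  rw [hcomm, ← Measure.map_map measurable_normalize hR]
  congr 1
  have hball : R ⁻¹' Metric.ball 0 1 = Metric.ball 0 1 := by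
    ext x
    simp
  rw [ProbabilityTheory.cond, Measure.map_smul]
  congr 1
  have := (R.measurePreserving.restrict_preimage (s := Metric.ball 0 1)
    measurableSet_ball).map_eq
  rwa [hball] at this

/-- A reflection exchanging two unit vectors shows that the second moment is the same in all
directions, and over an orthonormal basis these moments add up to `1`. -/
lemma lintegral_inner_sq_sphereLaw {u : EuclideanSpace ℝ (Fin m)} (hu : ‖u‖ = 1) :
    ∫⁻ x, ENNReal.ofReal (⟪u, x⟫_ℝ ^ 2) ∂(sphereLaw m) = (m : ℝ≥0∞)⁻¹ := by
  have hm : m ≠ 0 := by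
    rintro rfl
    have : u = 0 := Subsingleton.elim _ _
    simp [this] at hu
  have hinv : ∀ v : EuclideanSpace ℝ (Fin m), ‖v‖ = 1 →
      ∫⁻ x, ENNReal.ofReal (⟪v, x⟫_ℝ ^ 2) ∂(sphereLaw m)
        = ∫⁻ x, ENNReal.ofReal (⟪u, x⟫_ℝ ^ 2) ∂(sphereLaw m) := fun v hv => by
    let R := (ℝ ∙ (v - u))ᗮ.reflection
    have hRv : R v = u := Submodule.reflection_sub (hv.trans hu.symm)
    rw [← (measurePreserving_sphereLaw R).lintegral_comp
      (f := fun x => ENNReal.ofReal (⟪u, x⟫_ℝ ^ 2)) (by fun_prop)]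
    refine lintegral_congr fun x => ?_
    rw [← hRv, R.inner_map_map]
  let B := EuclideanSpace.basisFun (Fin m) ℝ
  have hsum : ∑ i, ∫⁻ x, ENNReal.ofReal (⟪B i, x⟫_ℝ ^ 2) ∂(sphereLaw m) = 1 := by
    rw [← lintegral_finsetSum _ (by fun_prop)]
    have : ∀ᵐ x ∂(sphereLaw m), ∑ i, ENNReal.ofReal (⟪B i, x⟫_ℝ ^ 2) = 1 := by
      filter_upwards [ae_norm_eq_one_sphereLaw hm] with x hx
      rw [← ENNReal.ofReal_sum_of_nonneg fun i _ => sq_nonneg _]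
      have := B.sum_sq_norm_inner_right x
      simp only [Real.norm_eq_abs, sq_abs] at this
      rw [this, hx]
      simp
    rw [lintegral_congr_ae this]
    simp
  simp_rw [fun i => hinv (B i) (B.orthonormal.1 i)] at hsum
  rw [Finset.sum_const, Finset.card_univ, Fintype.card_fin, nsmul_eq_mul, mul_comm] at hsum
  exact ENNReal.eq_inv_of_mul_eq_one_left hsum

/-- Parseval in an orthonormal basis of `Z` reduces this to single directions. -/
lemma lintegral_norm_starProjection_sq_sphereLaw (Z : Submodule ℝ (EuclideanSpace ℝ (Fin m))) :
    ∫⁻ x, ENNReal.ofReal (‖Z.starProjection x‖ ^ 2) ∂(sphereLaw m)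
      = (Module.finrank ℝ Z : ℝ≥0∞) * (m : ℝ≥0∞)⁻¹ := by
  let B := stdOrthonormalBasis ℝ Z
  have h : ∀ x, ENNReal.ofReal (‖Z.starProjection x‖ ^ 2)
      = ∑ i, ENNReal.ofReal (⟪(B i : EuclideanSpace ℝ (Fin m)), x⟫_ℝ ^ 2) := fun x => by
    rw [← ENNReal.ofReal_sum_of_nonneg fun i _ => sq_nonneg _]
    have := B.sum_sq_norm_inner_right (Z.orthogonalProjectionOnto x)
    simp only [Real.norm_eq_abs, sq_abs] at this
    congr 1
    rw [Submodule.starProjection_apply]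
    refine this.symm.trans (Finset.sum_congr rfl fun i _ => ?_)
    rw [Submodule.inner_orthogonalProjectionOnto_eq_of_mem_left]
  have h1 : ∀ i, ∫⁻ x, ENNReal.ofReal (⟪(B i : EuclideanSpace ℝ (Fin m)), x⟫_ℝ ^ 2)
      ∂(sphereLaw m) = (m : ℝ≥0∞)⁻¹ := fun i =>
    lintegral_inner_sq_sphereLaw (B.orthonormal.1 i)
  simp_rw [h]
  rw [lintegral_finsetSum _ (by fun_prop)]
  simp_rw [h1]
  simp

end Sphere

/-! ### Lower bound for arbitrary linear information -/

section LowerBound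

variable {d : ℕ} {P : ApproxProblem.{u} d} {m : ℕ} {s : ℝ} {e : Fin m → P.F} {l : Fin m → ℝ}

/-- The linear combination of the vectors `e` with coefficients `x`. -/
noncomputable def combine (e : Fin m → P.F) : EuclideanSpace ℝ (Fin m) →ₗ[ℝ] P.F where
  toFun x := ∑ i, x i • e i
  map_add' x y := by simp [add_smul, Finset.sum_add_distrib]
  map_smul' c x := by simp [mul_smul, Finset.smul_sum]

lemma combine_apply (e : Fin m → P.F) (x : EuclideanSpace ℝ (Fin m)) :
    combine e x = ∑ i, x i • e i := rfl

lemma IsLargeEigenfamily.norm_combine (h : IsLargeEigenfamily P.appL s e l)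
    (x : EuclideanSpace ℝ (Fin m)) : ‖combine e x‖ = ‖x‖ := by
  rw [← sq_eq_sq₀ (norm_nonneg _) (norm_nonneg _), ← real_inner_self_eq_norm_sq, combine_apply,
    h.1.inner_sum, EuclideanSpace.real_norm_sq_eq]
  simp [sq]

/-- The images of the `e i` are orthogonal with squared norms `l i > s²`. -/
lemma IsLargeEigenfamily.le_norm_app_combine (h : IsLargeEigenfamily P.appL s e l)
    (x : EuclideanSpace ℝ (Fin m)) : s ^ 2 * ‖x‖ ^ 2 ≤ ‖P.app (combine e x)‖ ^ 2 := by
  have : ‖P.app (combine e x)‖ ^ 2 = ∑ i, l i * x i ^ 2 := by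
    rw [← real_inner_self_eq_norm_sq]
    nth_rw 1 [combine_apply]
    rw [map_sum, sum_inner]
    refine Finset.sum_congr rfl fun i _ => ?_
    have h1 := h.2.1 i (combine e x)
    rw [P.appL_apply, P.appL_apply] at h1
    rw [map_smul, real_inner_smul_left, h1, combine_apply, h.1.inner_right_fintype]
    ring
  rw [this, EuclideanSpace.real_norm_sq_eq, Finset.mul_sum]
  exact Finset.sum_le_sum fun i _ => mul_le_mul_of_nonneg_right (h.2.2 i).le (sq_nonneg _)

/-- The subspace on which the first `K` functionals vanish. -/
noncomputable def commonKernel (e : Fin m → P.F) (L : ℕ → P.F →ₗ[ℝ] ℝ) (K : ℕ) :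
    Submodule ℝ (EuclideanSpace ℝ (Fin m)) :=
  LinearMap.ker (LinearMap.pi fun j : Fin K => (L j).comp (combine e))

lemma le_finrank_commonKernel (e : Fin m → P.F) (L : ℕ → P.F →ₗ[ℝ] ℝ) (K : ℕ) :
    m - K ≤ Module.finrank ℝ (commonKernel e L K) := by
  have h := LinearMap.finrank_range_add_finrank_ker
    (LinearMap.pi fun j : Fin K => (L j).comp (combine e))
  have h2 := Submodule.finrank_le (LinearMap.range
    (LinearMap.pi fun j : Fin K => (L j).comp (combine e)))
  simp only [finrank_euclideanSpace, Fintype.card_fin, Module.finrank_fin_fun] at h h2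
  unfold commonKernel
  omega

/-- If two inputs cannot be distinguished by the first `K` functionals and the method stops for the
first input after at most `K` steps, then the method yields the same output for both. -/
lemma Method.run_eq_of_agree {Λ : InfoClass} (A : Method P Λ) {K : ℕ} {f g : P.F}
    (hfg : ∀ j < K, A.L j f = A.L j g) (hK : A.numInfo f ≤ K) : A.run g = A.run f := by
  have hval : ∀ k ≤ K, (fun j : Fin k => A.L j f) = fun j : Fin k => A.L j g := fun k hk => by
    funext j
    exact hfg j (j.2.trans_le hk)
  have hf : A.halt (A.numInfo f) fun j => A.L j f := Nat.sInf_mem (A.terminates f)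
  have hg : A.halt (A.numInfo g) fun j => A.L j g := Nat.sInf_mem (A.terminates g)
  -- The stopping rule sees only values on which the inputs agree: `g` stops no later than `f`,
  -- hence within `K` steps, and then the roles can be exchanged.
  have hle : A.numInfo g ≤ A.numInfo f := Nat.sInf_le (by
    rw [hval _ hK] at hf
    exact hf)
  have hge : A.numInfo f ≤ A.numInfo g := Nat.sInf_le (by
    rw [← hval _ (hle.trans hK)] at hg
    exact hg)
  have heq := le_antisymm hle hge
  unfold Method.run
  rw [heq, hval _ hK]

/-- The functionals of a method are fixed in advance and only the stopping is adaptive, so the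
common kernel `Z` of the first `K` of them does not depend on the input. The reflection `R` flips
the `Z`-component of `x`. If the method stops on `x` within `K` steps, it gives the same output for
`x` and `R x`, whose images differ by at least `2 s` times the norm of that component. Its mean
square is `dim Z / m ≥ (m - K) / m`. Inputs that need more than `K` values are paid for by Markov's
inequality, the last term. -/
lemma Method.le_average_error {Λ : InfoClass} (A : Method P Λ)
    (h : IsLargeEigenfamily P.appL s e l) {K : ℕ} (hm : m ≠ 0) (hK : K ≠ 0)
    (hrun : StronglyMeasurable fun x : EuclideanSpace ℝ (Fin m) => A.run (combine e x))
    (hnum : Measurable fun x : EuclideanSpace ℝ (Fin m) => A.numInfo (combine e x)) :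
    ENNReal.ofReal (s ^ 2) * (((m - K : ℕ) : ℝ≥0∞) * (m : ℝ≥0∞)⁻¹)
      ≤ ∫⁻ x, ‖P.app (combine e x) - A.run (combine e x)‖ₑ ^ 2 ∂(sphereLaw m)
        + ENNReal.ofReal (s ^ 2) *
          ((∫⁻ x, (A.numInfo (combine e x) : ℝ≥0∞) ∂(sphereLaw m)) * (K : ℝ≥0∞)⁻¹) := by
  let Z := commonKernel e A.L K
  let R := Zᗮ.reflection
  let Q : EuclideanSpace ℝ (Fin m) → ℝ≥0∞ := fun x =>
    ‖P.app (combine e x) - A.run (combine e x)‖ₑ ^ 2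
  have happ : Continuous fun x : EuclideanSpace ℝ (Fin m) => P.app (combine e x) :=
    P.appL.continuous.comp (LinearMap.continuous_of_finiteDimensional (combine e))
  have hQ : Measurable Q := ((happ.stronglyMeasurable.sub hrun).enorm).pow_const 2
  have hR := measurePreserving_sphereLaw R
  have hnum' : Measurable fun x : EuclideanSpace ℝ (Fin m) =>
      (A.numInfo (combine e x) : ℝ≥0∞) :=
    (measurable_from_top (f := fun n : ℕ => (n : ℝ≥0∞))).comp hnum
  have hxR : ∀ x, x - R x = (2 : ℝ) • Z.starProjection x := fun x => by
    have h1 : R x = (2 : ℝ) • Zᗮ.starProjection x - x := by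
      rw [two_smul]
      exact (Submodule.reflection_apply x).trans (by rw [two_nsmul])
    rw [h1, Submodule.starProjection_orthogonal']
    simp only [two_smul, sub_apply, one_apply_eq_self]
    abel
  have hpt : ∀ᵐ x ∂(sphereLaw m), ENNReal.ofReal (s ^ 2) *
      ENNReal.ofReal (‖Z.starProjection x‖ ^ 2) ≤ 2⁻¹ * (Q x + Q (R x)) +
        ENNReal.ofReal (s ^ 2) * ((A.numInfo (combine e x) : ℝ≥0∞) * (K : ℝ≥0∞)⁻¹) := by
    filter_upwards [ae_norm_eq_one_sphereLaw hm] with x hx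
    by_cases hxK : A.numInfo (combine e x) ≤ K
    · refine le_trans ?_ le_self_add
      have hz : Z.starProjection x ∈ Z := Submodule.starProjection_apply_mem _ _
      have hagree : ∀ j < K, A.L j (combine e x) = A.L j (combine e (R x)) := fun j hj => by
        have h1 : A.L j (combine e (Z.starProjection x)) = 0 :=
          congrFun (LinearMap.mem_ker.1 hz) ⟨j, hj⟩
        have h2 : A.L j (combine e (x - R x)) = 0 := by
          rw [hxR, map_smul, map_smul, h1, smul_zero]
        rw [map_sub, map_sub, sub_eq_zero] at h2
        exact h2
      have hrunR := A.run_eq_of_agree hagree hxK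
      have h3 : P.app (combine e x) - P.app (combine e (R x))
          = (2 : ℝ) • P.app (combine e (Z.starProjection x)) := by
        rw [← map_sub, ← map_sub, hxR, map_smul, map_smul]
      have h4 := h.le_norm_app_combine (Z.starProjection x)
      simp only [Q]
      rw [hrunR]
      generalize A.run (combine e x) = o at *
      generalize P.app (combine e x) = a at *
      generalize P.app (combine e (R x)) = a' at *
      have h5 : ‖a - a'‖ ^ 2 = 4 * ‖P.app (combine e (Z.starProjection x))‖ ^ 2 := by
        rw [h3, norm_smul]
        norm_num
        ring
      have h6 : ‖a - a'‖ ≤ ‖a - o‖ + ‖a' - o‖ := by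
        have := norm_sub_le (a - o) (a' - o)
        simpa using this
      -- Here `‖a - a'‖² ≤ 2 (‖a - o‖² + ‖a' - o‖²)`, with the left side equal to four times the
      -- squared norm of the image of the projection.
      have h7 : s ^ 2 * ‖Z.starProjection x‖ ^ 2 ≤ 2⁻¹ * (‖a - o‖ ^ 2 + ‖a' - o‖ ^ 2) := by
        nlinarith [sq_nonneg (‖a - o‖ - ‖a' - o‖), norm_nonneg (a - a'), norm_nonneg (a - o),
          norm_nonneg (a' - o)]
      rw [← ENNReal.ofReal_mul (by positivity), ← ofReal_norm, ← ofReal_norm,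
        ← ENNReal.ofReal_pow (by positivity), ← ENNReal.ofReal_pow (by positivity),
        ← ENNReal.ofReal_add (by positivity) (by positivity),
        show (2⁻¹ : ℝ≥0∞) = ENNReal.ofReal 2⁻¹ by
          rw [ENNReal.ofReal_inv_of_pos two_pos, ENNReal.ofReal_ofNat],
        ← ENNReal.ofReal_mul (by positivity)]
      exact ENNReal.ofReal_le_ofReal h7
    -- Pointwise Markov inequality: the left side is at most `s²`, and `numInfo / K ≥ 1`.
    · refine le_trans ?_ le_add_self
      gcongr
      have h1 : ENNReal.ofReal (‖Z.starProjection x‖ ^ 2) ≤ 1 := by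
        rw [ENNReal.ofReal_le_one]
        have := Z.norm_starProjection_apply_le x
        rw [hx] at this
        exact pow_le_one₀ (norm_nonneg _) this
      refine h1.trans ?_
      rw [← div_eq_mul_inv, ENNReal.le_div_iff_mul_le (by simp [hK]) (by simp), one_mul]
      exact_mod_cast (not_le.1 hxK).le
  calc _ ≤ ENNReal.ofReal (s ^ 2) * ((Module.finrank ℝ Z : ℝ≥0∞) * (m : ℝ≥0∞)⁻¹) := by
        gcongr
        exact_mod_cast le_finrank_commonKernel e A.L K
    _ = ∫⁻ x, ENNReal.ofReal (s ^ 2) * ENNReal.ofReal (‖Z.starProjection x‖ ^ 2)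
          ∂(sphereLaw m) := by
        rw [lintegral_const_mul _ (by fun_prop), lintegral_norm_starProjection_sq_sphereLaw]
    _ ≤ _ := lintegral_mono_ae hpt
    _ = _ := by
        have hQR : Measurable fun x => Q x + Q (R x) := hQ.add (hQ.comp hR.measurable)
        rw [lintegral_add_right _ ((hnum'.mul_const _).const_mul _), lintegral_const_mul _ hQR,
          lintegral_add_left hQ, hR.lintegral_comp hQ, lintegral_const_mul _ (hnum'.mul_const _),
          lintegral_mul_const _ hnum']
        congr 1
        rw [← two_mul, ← mul_assoc, ENNReal.inv_mul_cancel (by simp) (by simp), one_mul]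

/-- Tonelli's theorem for an upper bound. -/
lemma lintegral_lintegral_le_of_ae {X Y : Type*} [MeasurableSpace X] [MeasurableSpace Y]
    {μ : Measure X} [IsProbabilityMeasure μ] {ν : Measure Y} [SFinite ν] {Q : X × Y → ℝ≥0∞}
    (hQ : Measurable Q) {c : ℝ≥0∞} (h : ∀ᵐ x ∂μ, ∫⁻ y, Q (x, y) ∂ν ≤ c) :
    ∫⁻ y, ∫⁻ x, Q (x, y) ∂μ ∂ν ≤ c := by
  rw [lintegral_lintegral_swap (f := fun y x => Q (x, y)) (hQ.comp measurable_swap).aemeasurable]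
  exact (lintegral_mono_ae h).trans (by simp)

/-- Lower bound for the error of randomized algorithms with arbitrary linear information. -/
theorem RandAlg.le_err_sq {Λ : InfoClass} (A : RandAlg P Λ)
    (h : IsLargeEigenfamily P.appL s e l) {K : ℕ} (hm : m ≠ 0) (hK : K ≠ 0) :
    ENNReal.ofReal (s ^ 2) * (((m - K : ℕ) : ℝ≥0∞) * (m : ℝ≥0∞)⁻¹)
      ≤ A.err ^ 2 + ENNReal.ofReal (s ^ 2) * (A.card * (K : ℝ≥0∞)⁻¹) := by
  have hcoord : Measurable fun p : EuclideanSpace ℝ (Fin m) × A.Ω =>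
      ((fun i => p.1 i, p.2) : (Fin m → ℝ) × A.Ω) := by
    refine Measurable.prodMk (measurable_pi_lambda _ fun i => ?_) measurable_snd
    fun_prop
  have hrun : StronglyMeasurable fun p : EuclideanSpace ℝ (Fin m) × A.Ω =>
      (A.method p.2).run (combine e p.1) := (A.measurable_run m e).comp_measurable hcoord
  have hnum : Measurable fun p : EuclideanSpace ℝ (Fin m) × A.Ω =>
      (A.method p.2).numInfo (combine e p.1) := (A.measurable_numInfo m e).comp hcoord
  have hnum' : Measurable fun p : EuclideanSpace ℝ (Fin m) × A.Ω =>
      ((A.method p.2).numInfo (combine e p.1) : ℝ≥0∞) :=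
    (measurable_from_top (f := fun n : ℕ => (n : ℝ≥0∞))).comp hnum
  have happ : Continuous fun x : EuclideanSpace ℝ (Fin m) => P.app (combine e x) :=
    P.appL.continuous.comp (LinearMap.continuous_of_finiteDimensional (combine e))
  have hQ : Measurable fun p : EuclideanSpace ℝ (Fin m) × A.Ω =>
      ‖P.app (combine e p.1) - (A.method p.2).run (combine e p.1)‖ₑ ^ 2 :=
    (((happ.stronglyMeasurable.comp_measurable measurable_fst).sub hrun).enorm).pow_const 2
  have hball : ∀ᵐ x ∂(sphereLaw m), ‖combine e x‖ ≤ 1 := by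
    filter_upwards [ae_norm_eq_one_sphereLaw hm] with x hx
    rw [h.norm_combine, hx]
  -- Almost every input lies in the unit ball, so after Tonelli the average over inputs is bounded
  -- by the worst case.
  have herr : ∫⁻ ω, ∫⁻ x, ‖P.app (combine e x) - (A.method ω).run (combine e x)‖ₑ ^ 2
      ∂(sphereLaw m) ∂A.prob ≤ A.err ^ 2 := by
    refine lintegral_lintegral_le_of_ae hQ ?_
    filter_upwards [hball] with x hx
    have h1 : (∫⁻ ω, ‖P.app (combine e x) - (A.method ω).run (combine e x)‖ₑ ^ 2
        ∂A.prob) ^ (1 / 2 : ℝ) ≤ A.err := le_iSup₂_of_le (combine e x) hx le_rfl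
    calc _ = ((∫⁻ ω, ‖P.app (combine e x) - (A.method ω).run (combine e x)‖ₑ ^ 2
          ∂A.prob) ^ (1 / 2 : ℝ)) ^ 2 := by
          rw [← ENNReal.rpow_natCast, ← ENNReal.rpow_mul]
          norm_num
      _ ≤ _ := by gcongr
  have hcard : ∫⁻ ω, ∫⁻ x, ((A.method ω).numInfo (combine e x) : ℝ≥0∞) ∂(sphereLaw m) ∂A.prob
      ≤ A.card := by
    refine lintegral_lintegral_le_of_ae hnum' ?_
    filter_upwards [hball] with x hx
    exact le_iSup₂_of_le (combine e x) hx le_rfl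
  calc _ = ∫⁻ ω, ENNReal.ofReal (s ^ 2) * (((m - K : ℕ) : ℝ≥0∞) * (m : ℝ≥0∞)⁻¹) ∂A.prob := by
        simp
    _ ≤ _ := lintegral_mono fun ω => (A.method ω).le_average_error h hm hK
        (hrun.comp_measurable measurable_prodMk_right) (hnum.comp measurable_prodMk_right)
    _ ≤ _ := by
        rw [lintegral_add_left hQ.lintegral_prod_left',
          lintegral_const_mul _ (hnum'.lintegral_prod_left'.mul_const _),
          lintegral_mul_const _ hnum'.lintegral_prod_left']
        gcongr

end LowerBound

/-! ### Comparison of the information complexities -/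

section Comparison

variable {d : ℕ} {P : ApproxProblem.{u} d} {m : ℕ} {s : ℝ} {e : Fin m → P.F} {l : Fin m → ℝ}

/-- Any algorithm may be viewed as an algorithm that uses arbitrary linear functionals. -/
def Method.toAll {Λ : InfoClass} (A : Method P Λ) : Method P .all :=
  { A with L_mem := fun _ => Set.mem_univ _ }

/-- Any randomized algorithm may be viewed as one that uses arbitrary linear functionals. -/
def RandAlg.toAll {Λ : InfoClass} (A : RandAlg P Λ) : RandAlg P .all where
  Ω := A.Ω
  prob := A.prob
  method ω := (A.method ω).toAll
  measurable_run := A.measurable_run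
  measurable_numInfo := A.measurable_numInfo
  nodes_ae h := by cases h

lemma minError_all_le (P : ApproxProblem.{u} d) (Λ : InfoClass) (n : ℕ) :
    minError P .all n ≤ minError P Λ n := by
  cases n with
  | zero => exact le_rfl
  | succ n => exact le_iInf₂ fun A hA => iInf₂_le A.toAll hA

lemma infoComplexity_all_le (APP : (d : ℕ+) → ApproxProblem.{u} d) (c : Criterion) (Λ : InfoClass)
    (ε : ℝ) (d : ℕ+) : infoComplexity APP c .all ε d ≤ infoComplexity APP c Λ ε d :=
  le_iInf₂ fun n hn => iInf₂_le n ((minError_all_le _ _ n).trans hn)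

lemma initialError_le {P : ApproxProblem.{u} d} {s : ℝ} (hs0 : 0 ≤ s)
    (hs : ∀ g, ‖P.appL g‖ ≤ s * ‖g‖) : initialError P ≤ ENNReal.ofReal s := by
  refine iSup₂_le fun f hf => ?_
  rw [← ofReal_norm]
  exact ENNReal.ofReal_le_ofReal ((hs f).trans (by nlinarith))

lemma initialError_ne_top (P : ApproxProblem.{u} d) : initialError P ≠ ⊤ :=
  ((initialError_le (norm_nonneg _) P.appL.le_opNorm).trans_lt ENNReal.ofReal_lt_top).ne

lemma cri_ne_top (P : ApproxProblem.{u} d) (c : Criterion) : c.cri P ≠ ⊤ := by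
  cases c
  · exact ENNReal.one_ne_top
  · exact initialError_ne_top P

/-- The number of descent steps that suffices to reach the optimal order of the error. -/
noncomputable def numSteps (θ : ℝ) (m : ℕ) : ℕ := ⌈m / θ * Real.log (m / θ)⌉₊

/-- By `1 - x ≤ exp (-x)`, the number of steps is just large enough for the power to fall below `θ /
m`. -/
lemma pow_numSteps_le {θ : ℝ} (hθ : 0 < θ) (hθ1 : θ ≤ 1) (hm : m ≠ 0) :
    (1 - θ / m) ^ numSteps θ m * m ≤ θ := by
  have hm0 : (0 : ℝ) < m := by positivity
  have hm1 : (1 : ℝ) ≤ m := by exact_mod_cast Nat.one_le_iff_ne_zero.2 hm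
  have hfac : 0 ≤ 1 - θ / m := by
    rw [sub_nonneg, div_le_one hm0]
    linarith
  have h1 : (1 - θ / m) ^ numSteps θ m ≤ θ / m := by
    calc (1 - θ / m) ^ numSteps θ m ≤ Real.exp (-(θ / m)) ^ numSteps θ m :=
          pow_le_pow_left₀ hfac (Real.one_sub_le_exp_neg _) _
      _ = Real.exp (-(θ / m * numSteps θ m)) := by
          rw [← Real.exp_nat_mul]
          congr 1
          ring
      _ ≤ Real.exp (-Real.log (m / θ)) := by
          apply Real.exp_le_exp.2
          have := Nat.le_ceil (m / θ * Real.log (m / θ))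
          rw [neg_le_neg_iff]
          calc Real.log (m / θ) = θ / m * (m / θ * Real.log (m / θ)) := by field_simp
            _ ≤ _ := mul_le_mul_of_nonneg_left this (by positivity)
      _ = θ / m := by
          rw [← Real.log_inv, Real.exp_log (by positivity), inv_div]
  calc _ ≤ θ / m * m := by gcongr
    _ = θ := by field_simp

/-- The logarithm is absorbed by `log x ≤ x ^ δ / δ`; the summand `2` covers the `m` interpolation
points and the rounding. -/
lemma add_numSteps_le {θ δ : ℝ} (hθ : 0 < θ) (hθ1 : θ ≤ 1) (hδ : 0 < δ) (hm : m ≠ 0) :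
    ((m + numSteps θ m : ℕ) : ℝ) ≤ (2 + θ⁻¹ ^ (1 + δ) / δ) * (m : ℝ) ^ (1 + δ) := by
  have hm0 : (0 : ℝ) < m := by positivity
  have hm1 : (1 : ℝ) ≤ m := by exact_mod_cast Nat.one_le_iff_ne_zero.2 hm
  have hdiv : 1 ≤ m / θ := by
    rw [one_le_div hθ]
    linarith
  have h1 : (numSteps θ m : ℝ) ≤ m / θ * Real.log (m / θ) + 1 :=
    (Nat.ceil_lt_add_one (mul_nonneg (by positivity) (Real.log_nonneg hdiv))).le
  have h2 : m / θ * Real.log (m / θ) ≤ θ⁻¹ ^ (1 + δ) / δ * (m : ℝ) ^ (1 + δ) := by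
    calc m / θ * Real.log (m / θ) ≤ m / θ * ((m / θ) ^ δ / δ) := by
          gcongr
          exact Real.log_le_rpow_div (by positivity) hδ
      _ = (m / θ) ^ (1 + δ) / δ := by
          rw [Real.rpow_add (by positivity), Real.rpow_one]
          ring
      _ = _ := by
          rw [div_eq_mul_inv (m : ℝ) θ, Real.mul_rpow (by positivity) (by positivity)]
          ring
  have h3 : (m : ℝ) ≤ (m : ℝ) ^ (1 + δ) := by
    conv_lhs => rw [← Real.rpow_one (m : ℝ)]
    exact Real.rpow_le_rpow_of_exponent_le hm1 (by linarith)
  push_cast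
  nlinarith

lemma IsLargeEigenfamily.minError_numSteps_le (h : IsLargeEigenfamily P.appL s e l)
    (hs : ∀ g, (∀ i, ⟪e i, g⟫_ℝ = 0) → ‖P.appL g‖ ≤ s * ‖g‖) (hs0 : 0 ≤ s)
    {Λ : InfoClass} (hΛ : Λ = .std ∨ Λ = .stdAE) (hm : m ≠ 0) {θ : ℝ} (hθ : 0 < θ) (hθ1 : θ ≤ 1) :
    minError P Λ (m + numSteps θ m) ≤ ENNReal.ofReal (Real.sqrt (1 + 2 * θ) * s) := by
  obtain ⟨E⟩ := exists_estimator h.isOrthonormalSystem hm hθ.le hθ1 (numSteps θ m)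
  have E' := E.mono (B' := 2 * θ) (by linarith [pow_numSteps_le hθ hθ1 hm])
  have := h.minError_le hs hs0 hΛ (by omega) (by positivity) E'
  rwa [add_comm (2 * θ) 1] at this

/-- The number of large singular values is bounded by the information complexity for arbitrary
linear information. -/
lemma IsLargeEigenfamily.card_le {t δ : ℝ} (ht : 0 < t) (hδ : 0 < δ) (hδ1 : δ ≤ 1)
    (h : IsLargeEigenfamily P.appL (t * Real.sqrt (1 + δ)) e l) {n : ℕ} (hn : n ≠ 0)
    {Λ : InfoClass} (herr : minError P Λ n ≤ ENNReal.ofReal t) {a : ℕ} (ha : 8 / δ ≤ a) :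
    m ≤ a ^ 2 * n := by
  by_contra! hmn
  have ha0 : (0 : ℝ) < a := lt_of_lt_of_le (by positivity) ha
  have ha' : a ≠ 0 := by
    rintro rfl
    simp at ha0
  have hm : m ≠ 0 := by omega
  have hm0 : (0 : ℝ) < m := by positivity
  have hn0 : (0 : ℝ) < n := by positivity
  have hs2 : (t * Real.sqrt (1 + δ)) ^ 2 = t ^ 2 * (1 + δ) := by
    rw [mul_pow, Real.sq_sqrt (by positivity)]
  have hinv : (a : ℝ)⁻¹ ≤ δ / 8 := by
    rw [inv_le_comm₀ ha0 (by positivity), inv_div]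
    exact ha
  have hlow : ∀ A : RandAlg P Λ, A.card ≤ (n : ℝ≥0∞) →
      ENNReal.ofReal (t * Real.sqrt (1 + δ / 2)) ≤ A.err := fun A hA => by
    -- With `K = a n` and `m > a² n`, both `K / m` and `card / K` are at most `1 / a`, so the
    -- squared error is at least `s² (1 - 2 / a)`.
    have h1 := A.le_err_sq h hm (K := a * n) (mul_ne_zero ha' hn)
    have h2 : ENNReal.ofReal (t ^ 2 * (1 + δ) * (1 - (a : ℝ)⁻¹)) ≤
        A.err ^ 2 + ENNReal.ofReal (t ^ 2 * (1 + δ) * (a : ℝ)⁻¹) := by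
      rw [hs2] at h1
      refine le_trans ?_ (h1.trans ?_)
      · rw [ENNReal.ofReal_mul (by positivity)]
        gcongr
        rw [← ENNReal.ofReal_natCast, ← ENNReal.ofReal_natCast, ← ENNReal.ofReal_inv_of_pos hm0,
          ← ENNReal.ofReal_mul (by positivity)]
        apply ENNReal.ofReal_le_ofReal
        have hK : a * n ≤ m := by nlinarith [Nat.pos_of_ne_zero ha']
        have hmn' : ((a : ℝ) ^ 2 * n) ≤ m := by exact_mod_cast hmn.le
        rw [Nat.cast_sub hK, sub_mul, mul_inv_cancel₀ hm0.ne']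
        push_cast
        have : (a : ℝ) * n * (m : ℝ)⁻¹ ≤ (a : ℝ)⁻¹ := by
          rw [← div_eq_mul_inv, div_le_iff₀ hm0, inv_mul_eq_div, le_div_iff₀ ha0]
          nlinarith
        linarith
      · gcongr
        rw [ENNReal.ofReal_mul (p := t ^ 2 * (1 + δ)) (by positivity)]
        gcongr
        calc A.card * ((a * n : ℕ) : ℝ≥0∞)⁻¹ ≤ (n : ℝ≥0∞) * ((a * n : ℕ) : ℝ≥0∞)⁻¹ := by gcongr
          _ = ENNReal.ofReal (n * ((a * n : ℕ) : ℝ)⁻¹) := by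
            rw [ENNReal.ofReal_mul (by positivity), ENNReal.ofReal_inv_of_pos (by positivity),
              ENNReal.ofReal_natCast, ENNReal.ofReal_natCast]
          _ ≤ ENNReal.ofReal (a : ℝ)⁻¹ := by
            apply ENNReal.ofReal_le_ofReal
            push_cast
            field_simp
            exact le_rfl
    have h3 : ENNReal.ofReal (t ^ 2 * (1 + δ / 2)) ≤ A.err ^ 2 := by
      rw [← tsub_le_iff_right, ← ENNReal.ofReal_sub _ (by positivity)] at h2
      refine le_trans (ENNReal.ofReal_le_ofReal ?_) h2
      -- As `1 / a ≤ δ / 8`, the right side is at least `(1 + δ) (1 - δ / 4)`; `δ ≤ 1` is used here.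
      have h4 : (1 + δ / 2) ≤ (1 + δ) * (1 - 2 * (a : ℝ)⁻¹) := by nlinarith
      nlinarith [sq_nonneg t, mul_le_mul_of_nonneg_left h4 (sq_nonneg t)]
    have h4 : ENNReal.ofReal (t * Real.sqrt (1 + δ / 2)) ^ 2 ≤ A.err ^ 2 := by
      rw [← ENNReal.ofReal_pow (by positivity), mul_pow, Real.sq_sqrt (by positivity)]
      exact h3
    exact (ENNReal.pow_le_pow_left_iff two_ne_zero).1 h4
  have hmin : ENNReal.ofReal (t * Real.sqrt (1 + δ / 2)) ≤ minError P Λ n := by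
    obtain ⟨n, rfl⟩ := Nat.exists_eq_succ_of_ne_zero hn
    exact le_iInf₂ hlow
  have h5 := hmin.trans herr
  rw [ENNReal.ofReal_le_ofReal_iff ht.le] at h5
  have h6 : 1 < Real.sqrt (1 + δ / 2) := by
    rw [Real.lt_sqrt (by norm_num)]
    linarith
  nlinarith

/-- Function values are almost as good as arbitrary linear information. -/
theorem exists_minError_std_le {δ : ℝ} (hδ : 0 < δ) (hδ1 : δ ≤ 1) : ∃ C : ℝ, 0 < C ∧
    ∀ (d : ℕ) (P : ApproxProblem.{u} d) (c : Criterion) (Λ : InfoClass),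
      (Λ = .std ∨ Λ = .stdAE) → ∀ (ε : ℝ), 0 < ε → ∀ n : ℕ,
        minError P .all n ≤ ENNReal.ofReal ε * c.cri P →
        ∃ N : ℕ, minError P Λ N ≤ ENNReal.ofReal ((1 + δ) * ε) * c.cri P ∧
          (N : ℝ) ≤ C * (n : ℝ) ^ (1 + δ) := by
  obtain ⟨a, ha⟩ := exists_nat_ge (8 / δ)
  have ha0 : (0 : ℝ) < a := lt_of_lt_of_le (by positivity) ha
  -- The first factor is the cost of the descent with `θ = δ / 2`; the second comes from `m ≤ a² n`.
  refine ⟨(2 + (δ / 2)⁻¹ ^ (1 + δ) / δ) * ((a : ℝ) ^ 2) ^ (1 + δ), by positivity, ?_⟩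
  intro d P c Λ hΛ ε hε n hn
  have hεδ : ε ≤ (1 + δ) * ε := by nlinarith
  -- If the zero algorithm is already good enough, take `N = 0`. This also disposes of `n = 0` and
  -- of a vanishing `cri`.
  by_cases hzero : initialError P ≤ ENNReal.ofReal ((1 + δ) * ε) * c.cri P
  · exact ⟨0, hzero, by simp only [Nat.cast_zero]; positivity⟩
  have hn0 : n ≠ 0 := by
    rintro rfl
    refine hzero (hn.trans ?_)
    gcongr
  have hcri : c.cri P ≠ 0 := by
    intro h0
    cases c
    · exact one_ne_zero h0
    · exact hzero ((le_of_eq h0).trans zero_le)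
  set r := (c.cri P).toReal
  have hr0 : 0 < r := ENNReal.toReal_pos hcri (cri_ne_top P c)
  have hcr : c.cri P = ENNReal.ofReal r := (ENNReal.ofReal_toReal (cri_ne_top P c)).symm
  rw [hcr, ← ENNReal.ofReal_mul (by positivity)] at hn hzero ⊢
  have ht : 0 < ε * r := by positivity
  -- The slack `1 + δ` is split evenly: one factor `√(1 + δ)` for the lower bound, the other for the
  -- estimator with `1 + 2θ = 1 + δ`.
  have hs : 0 < ε * r * Real.sqrt (1 + δ) := by positivity
  obtain ⟨m, e, l, h, hsmall⟩ := exists_isLargeEigenfamily P.isCompactOperator_appL hs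
  have hsqrt : Real.sqrt (1 + 2 * (δ / 2)) * (ε * r * Real.sqrt (1 + δ)) = (1 + δ) * ε * r := by
    rw [mul_div_cancel₀ _ two_ne_zero]
    have := Real.mul_self_sqrt (show 0 ≤ 1 + δ by positivity)
    linear_combination ε * r * this
  have hm : m ≠ 0 := by
    rintro rfl
    refine hzero ((initialError_le hs.le fun g => hsmall g fun i => i.elim0).trans
      (ENNReal.ofReal_le_ofReal ?_))
    rw [← hsqrt]
    refine le_mul_of_one_le_left hs.le ?_
    rw [Real.one_le_sqrt]
    linarith
  refine ⟨m + numSteps (δ / 2) m, ?_, ?_⟩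
  · rw [← hsqrt]
    exact h.minError_numSteps_le hsmall hs.le hΛ hm (by positivity) (by linarith)
  · refine (add_numSteps_le (by positivity) (by linarith) hδ hm).trans ?_
    rw [mul_assoc, ← Real.mul_rpow (by positivity) (by positivity)]
    gcongr
    exact_mod_cast h.card_le ht hδ hδ1 hn0 hn ha

/-- Comparison of the information complexities. -/
theorem exists_infoComplexity_std_le {δ : ℝ} (hδ : 0 < δ) (hδ1 : δ ≤ 1)
    (APP : (d : ℕ+) → ApproxProblem.{u} d) (c : Criterion) {Λ : InfoClass}
    (hΛ : Λ = .std ∨ Λ = .stdAE) : ∃ C : ℝ, 0 < C ∧ ∀ (d : ℕ+) (ε : ℝ), 0 < ε →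
      (infoComplexity APP c Λ ε d : ℝ≥0∞) ≤ ENNReal.ofReal C *
        (infoComplexity APP c .all (ε / (1 + δ)) d : ℝ≥0∞) ^ (1 + δ) := by
  obtain ⟨C, hC, hCbound⟩ := exists_minError_std_le.{u} hδ hδ1
  refine ⟨C, hC, fun d ε hε => ?_⟩
  by_cases htop : infoComplexity APP c .all (ε / (1 + δ)) d = ⊤
  · rw [htop, ENat.toENNReal_top, ENNReal.top_rpow_of_pos (by positivity), ENNReal.mul_top]
    · exact le_top
    · simpa using hC
  obtain ⟨n, hn⟩ := ENat.ne_top_iff_exists.1 htop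
  have hlt : infoComplexity APP c .all (ε / (1 + δ)) d < ((n + 1 : ℕ) : ℕ∞) := by
    rw [← hn]
    exact_mod_cast Nat.lt_succ_self n
  obtain ⟨k, hk, hkn⟩ := by
    unfold infoComplexity at hlt
    simpa only [iInf_lt_iff] using hlt
  have hkn' : k ≤ n := by
    have : k < n + 1 := by exact_mod_cast hkn
    omega
  obtain ⟨N, hN, hNle⟩ := hCbound d (APP d) c Λ hΛ (ε / (1 + δ)) (by positivity) k hk
  rw [mul_div_cancel₀ _ (by positivity : (1 + δ) ≠ 0)] at hN
  have h1 : infoComplexity APP c Λ ε d ≤ (N : ℕ∞) := iInf₂_le N hN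
  rw [← hn, ENat.toENNReal_coe, ← ENNReal.ofReal_natCast, ENNReal.ofReal_rpow_of_nonneg
    (by positivity) (by positivity), ← ENNReal.ofReal_mul hC.le]
  refine (ENat.toENNReal_le.2 h1).trans ?_
  rw [ENat.toENNReal_coe, ← ENNReal.ofReal_natCast]
  apply ENNReal.ofReal_le_ofReal
  refine hNle.trans ?_
  gcongr

end Comparison

/-! ### Invariance of the tractability notions -/

section Tractability

variable {N M : ℝ → ℕ+ → ℕ∞}

/-- `M` is at most slightly larger than `N`, up to a slight change of the accuracy. -/
def AlmostDominates (N M : ℝ → ℕ+ → ℕ∞) : Prop :=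
  ∀ δ : ℝ, 0 < δ → δ ≤ 1 → ∃ C : ℝ, 0 < C ∧ ∀ (d : ℕ+) (ε : ℝ), 0 < ε →
    (M ε d : ℝ≥0∞) ≤ ENNReal.ofReal C * (N (ε / (1 + δ)) d : ℝ≥0∞) ^ (1 + δ)

lemma ExpSPTBound.anti (h : ∀ ε d, N ε d ≤ M ε d) {p : ℝ} (hM : ExpSPTBound M p) :
    ExpSPTBound N p := by
  obtain ⟨C, hC, hb⟩ := hM
  exact ⟨C, hC, fun d ε hε => (ENat.toENNReal_le.2 (h ε d)).trans (hb d ε hε)⟩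

lemma ExpQPTBound.anti (h : ∀ ε d, N ε d ≤ M ε d) {t : ℝ} (hM : ExpQPTBound M t) :
    ExpQPTBound N t := by
  obtain ⟨C, hC, hb⟩ := hM
  exact ⟨C, hC, fun d ε hε => (ENat.toENNReal_le.2 (h ε d)).trans (hb d ε hε)⟩

lemma ExpPT.anti (h : ∀ ε d, N ε d ≤ M ε d) (hM : ExpPT M) : ExpPT N := by
  obtain ⟨C, p, q, hC, hp, hq, hb⟩ := hM
  exact ⟨C, p, q, hC, hp, hq, fun d ε hε => (ENat.toENNReal_le.2 (h ε d)).trans (hb d ε hε)⟩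

lemma log_inv_div {ε δ : ℝ} (hε : 0 < ε) (hδ : 0 < δ) :
    Real.log (ε / (1 + δ))⁻¹ = Real.log ε⁻¹ + Real.log (1 + δ) := by
  rw [inv_div, div_eq_mul_inv, mul_comm, Real.log_mul (by positivity) (by positivity)]

lemma log_one_add_le {δ : ℝ} (hδ : 0 < δ) : Real.log (1 + δ) ≤ δ := by
  have := Real.log_le_sub_one_of_pos (show 0 < 1 + δ by positivity)
  linarith

lemma log_inv_pos {ε : ℝ} (hε : ε ∈ Set.Ioo (0 : ℝ) 1) : 0 < Real.log ε⁻¹ :=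
  Real.log_pos ((one_lt_inv₀ hε.1).2 hε.2)

lemma div_mem_Ioo {ε δ : ℝ} (hε : ε ∈ Set.Ioo (0 : ℝ) 1) (hδ : 0 < δ) :
    ε / (1 + δ) ∈ Set.Ioo (0 : ℝ) 1 :=
  ⟨div_pos hε.1 (by positivity), (div_lt_one (by positivity)).2 (by linarith [hε.2])⟩

lemma le_of_le_ofReal_rpow {x y : ℝ≥0∞} {C b c δ : ℝ} (hδ : 0 < δ) (hC : 0 < C) (hb : 0 ≤ b)
    (hxy : x ≤ ENNReal.ofReal C * y ^ (1 + δ)) (hy : y ≤ ENNReal.ofReal b)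
    (hbc : C * b ^ (1 + δ) ≤ c) : x ≤ ENNReal.ofReal c := by
  refine hxy.trans ((mul_le_mul_right (ENNReal.rpow_le_rpow hy (by positivity)) _).trans ?_)
  rw [ENNReal.ofReal_rpow_of_nonneg hb (by positivity), ← ENNReal.ofReal_mul hC.le]
  exact ENNReal.ofReal_le_ofReal hbc

/-- The change of `ε` adds at most `1` to `log ε⁻¹`, which the constant `2 ^ p` absorbs; only the
power `1 + δ` affects the exponent. -/
lemma AlmostDominates.expSPTBound (h : AlmostDominates N M) {p : ℝ} (hp : 0 ≤ p)
    (hN : ExpSPTBound N p) {δ : ℝ} (hδ : 0 < δ) (hδ1 : δ ≤ 1) :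
    ExpSPTBound M (p * (1 + δ)) := by
  obtain ⟨C, hC, hb⟩ := h δ hδ hδ1
  obtain ⟨C₁, hC₁, hb₁⟩ := hN
  refine ⟨C * (C₁ * 2 ^ p) ^ (1 + δ), by positivity, fun d ε hε => ?_⟩
  have hx := log_inv_pos hε
  have hl := log_one_add_le hδ
  have hl0 : 0 ≤ Real.log (1 + δ) := Real.log_nonneg (by linarith)
  have h1 := hb₁ d _ (div_mem_Ioo hε hδ)
  rw [log_inv_div hε.1 hδ] at h1
  refine le_of_le_ofReal_rpow hδ hC (by positivity) (hb d ε hε.1) h1 ?_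
  rw [mul_assoc, Real.rpow_mul (by positivity), ← Real.mul_rpow (by positivity) (by positivity),
    mul_assoc C₁, ← Real.mul_rpow (by positivity) (by positivity)]
  gcongr
  linarith

lemma AlmostDominates.expPT (h : AlmostDominates N M) (hN : ExpPT N) : ExpPT M := by
  obtain ⟨C, hC, hb⟩ := h 1 one_pos le_rfl
  obtain ⟨C₁, p, q, hC₁, hp, hq, hb₁⟩ := hN
  refine ⟨C * (C₁ * 2 ^ p) ^ (1 + 1 : ℝ), p * (1 + 1), q * (1 + 1), by positivity, by positivity,
    by positivity, fun d ε hε => ?_⟩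
  have hx := log_inv_pos hε
  have hl := log_one_add_le one_pos
  have hl0 : 0 ≤ Real.log (1 + 1) := Real.log_nonneg (by norm_num)
  have h1 := hb₁ d _ (div_mem_Ioo hε one_pos)
  rw [log_inv_div hε.1 one_pos] at h1
  refine le_of_le_ofReal_rpow one_pos hC (by positivity) (hb d ε hε.1) h1 ?_
  generalize Real.log (1 + 1) = y at hl hl0 h1 ⊢
  calc C * (C₁ * (d : ℝ) ^ q * (Real.log ε⁻¹ + y + 1) ^ p) ^ (1 + 1 : ℝ)
      ≤ C * (C₁ * (d : ℝ) ^ q * (2 * (Real.log ε⁻¹ + 1)) ^ p) ^ (1 + 1 : ℝ) := by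
        gcongr
        linarith
    _ = _ := by
        rw [Real.mul_rpow (x := 2) (by positivity) (by positivity),
          Real.mul_rpow (x := C₁ * (d : ℝ) ^ q) (by positivity) (by positivity),
          Real.mul_rpow (x := C₁) (by positivity) (by positivity),
          Real.mul_rpow (x := 2 ^ p) (by positivity) (by positivity),
          Real.mul_rpow (x := C₁) (by positivity) (by positivity),
          Real.rpow_mul (by positivity), Real.rpow_mul (by positivity)]
        ring

/-- One factor `1 + δ` is the power. The other pays for the change of `ε`, whose effect is
multiplied by `1 + log d` and so cannot go into the constant. -/
lemma AlmostDominates.expQPTBound (h : AlmostDominates N M) {t : ℝ} (ht : 0 ≤ t)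
    (hN : ExpQPTBound N t) {δ : ℝ} (hδ : 0 < δ) (hδ1 : δ ≤ 1) :
    ExpQPTBound M (t * (1 + δ) ^ 2) := by
  obtain ⟨C, hC, hb⟩ := h δ hδ hδ1
  obtain ⟨C₁, hC₁, hb₁⟩ := hN
  refine ⟨C * C₁ ^ (1 + δ), by positivity, fun d ε hε => ?_⟩
  have hx := log_inv_pos hε
  have hl := log_one_add_le hδ
  have hl0 : 0 ≤ Real.log (1 + δ) := Real.log_nonneg (by linarith)
  have h1 := hb₁ d _ (div_mem_Ioo hε hδ)
  rw [log_inv_div hε.1 hδ] at h1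
  refine le_of_le_ofReal_rpow hδ hC (by positivity) (hb d ε hε.1) h1 ?_
  rw [Real.mul_rpow hC₁.le (Real.exp_pos _).le, ← Real.exp_mul, ← mul_assoc]
  refine mul_le_mul_of_nonneg_left (Real.exp_le_exp.2 ?_) (by positivity)
  have hd : 0 ≤ Real.log (d : ℝ) := Real.log_nonneg (by exact_mod_cast one_le)
  have hlog : 1 + Real.log (Real.log ε⁻¹ + Real.log (1 + δ) + 1)
      ≤ (1 + δ) * (1 + Real.log (Real.log ε⁻¹ + 1)) := by
    have h2 : Real.log ε⁻¹ + Real.log (1 + δ) + 1 ≤ (1 + δ) * (Real.log ε⁻¹ + 1) := by nlinarith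
    have h3 := Real.log_le_log (by positivity) h2
    rw [Real.log_mul (by positivity) (by positivity)] at h3
    have h4 : 0 ≤ Real.log (Real.log ε⁻¹ + 1) := Real.log_nonneg (by linarith)
    nlinarith
  calc _ ≤ t * (1 + Real.log (d : ℝ)) * ((1 + δ) * (1 + Real.log (Real.log ε⁻¹ + 1))) * (1 + δ) := by
        gcongr
    _ = _ := by ring

/-- Letting `δ → 0` gives the inequality of exponents. The form `1 + 3 δ` serves both `1 + δ` and
`(1 + δ)²` for `δ ≤ 1`. -/
lemma iInf_le_iInf_of_forall_exists {A B : ℝ → Prop}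
    (h : ∀ p : ℝ, 0 ≤ p → A p → ∀ δ : ℝ, 0 < δ → δ ≤ 1 → ∃ q, 0 ≤ q ∧ q ≤ p * (1 + 3 * δ) ∧ B q) :
    ⨅ (p : ℝ≥0) (_ : B p), (p : ℝ≥0∞) ≤ ⨅ (p : ℝ≥0) (_ : A p), (p : ℝ≥0∞) := by
  refine le_iInf₂ fun p hp => ENNReal.le_of_forall_pos_le_add fun η hη _ => ?_
  have hη' : (0 : ℝ) < η := hη
  have hp0 : (0 : ℝ) ≤ p := p.2
  obtain ⟨q, hq0, hq, hB⟩ := h p hp0 hp (min 1 (η / (3 * (p + 1))))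
    (lt_min one_pos (by positivity)) (min_le_left _ _)
  lift q to ℝ≥0 using hq0
  refine (iInf₂_le q hB).trans ?_
  rw [← ENNReal.coe_add, ENNReal.coe_le_coe, ← NNReal.coe_le_coe]
  push_cast
  refine hq.trans ?_
  have h1 : (p : ℝ) * (3 * min (1 : ℝ) ((η : ℝ) / (3 * (p + 1)))) ≤ η := by
    calc (p : ℝ) * (3 * min (1 : ℝ) ((η : ℝ) / (3 * (p + 1))))
        ≤ (p + 1) * (3 * ((η : ℝ) / (3 * (p + 1)))) := by
          gcongr
          · linarith
          · exact min_le_right _ _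
      _ = η := by field_simp
  linarith

lemma AlmostDominates.expSPTExponent_eq (h : AlmostDominates N M) (hle : ∀ ε d, N ε d ≤ M ε d) :
    expSPTExponent N = expSPTExponent M := by
  refine le_antisymm (le_iInf₂ fun p hp => iInf₂_le p (hp.anti hle))
    (iInf_le_iInf_of_forall_exists (A := ExpSPTBound N) (B := ExpSPTBound M)
      fun p hp hN δ hδ hδ1 => ?_)
  exact ⟨p * (1 + δ), by positivity, by gcongr; linarith, h.expSPTBound hp hN hδ hδ1⟩

lemma AlmostDominates.expQPTExponent_eq (h : AlmostDominates N M) (hle : ∀ ε d, N ε d ≤ M ε d) :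
    expQPTExponent N = expQPTExponent M := by
  refine le_antisymm (le_iInf₂ fun p hp => iInf₂_le p (hp.anti hle))
    (iInf_le_iInf_of_forall_exists (A := ExpQPTBound N) (B := ExpQPTBound M)
      fun p hp hN δ hδ hδ1 => ?_)
  exact ⟨p * (1 + δ) ^ 2, by positivity, by gcongr; nlinarith, h.expQPTBound hp hN hδ hδ1⟩

lemma lnCard_mono {a b : ℕ∞} (hab : a ≤ b) : lnCard a ≤ lnCard b := by
  unfold lnCard
  by_cases hb : b = ⊤
  · simp [hb]
  obtain ⟨b, rfl⟩ := ENat.ne_top_iff_exists.1 hb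
  have ha : a ≠ ⊤ := (hab.trans_lt (ENat.natCast_lt_top b)).ne
  obtain ⟨a, rfl⟩ := ENat.ne_top_iff_exists.1 ha
  rw [if_neg ha, if_neg hb]
  apply ENNReal.ofReal_le_ofReal
  rw [ENat.toNat_natCast, ENat.toNat_natCast]
  have hab' : a ≤ b := by exact_mod_cast hab
  rcases Nat.eq_zero_or_pos a with rfl | ha0
  · simpa using Real.log_natCast_nonneg b
  · exact Real.log_le_log (by positivity) (by exact_mod_cast hab')

/-- The power `2` is `1 + δ` for `δ = 1`: weak tractability ignores a constant factor in front of
`lnCard`. `1 ≤ C` keeps `log C` nonnegative, as the convention for `a = 0` requires. -/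
lemma lnCard_le_of_le {a b : ℕ∞} {C : ℝ} (hC : 1 ≤ C)
    (hab : (a : ℝ≥0∞) ≤ ENNReal.ofReal C * (b : ℝ≥0∞) ^ (2 : ℝ)) :
    lnCard a ≤ ENNReal.ofReal (Real.log C) + 2 * lnCard b := by
  by_cases hb : b = ⊤
  · simp [lnCard, hb]
  obtain ⟨b, rfl⟩ := ENat.ne_top_iff_exists.1 hb
  rw [ENat.toENNReal_coe, ← ENNReal.ofReal_natCast, ENNReal.ofReal_rpow_of_nonneg (by positivity)
    (by positivity), ← ENNReal.ofReal_mul (by positivity), Real.rpow_two] at hab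
  have ha : a ≠ ⊤ := by
    rintro rfl
    simp at hab
  obtain ⟨a, rfl⟩ := ENat.ne_top_iff_exists.1 ha
  rw [ENat.toENNReal_coe, ← ENNReal.ofReal_natCast,
    ENNReal.ofReal_le_ofReal_iff (by positivity)] at hab
  unfold lnCard
  rw [if_neg ha, if_neg hb, ENat.toNat_natCast, ENat.toNat_natCast, ← ENNReal.ofReal_ofNat,
    ← ENNReal.ofReal_mul (by norm_num), ← ENNReal.ofReal_add (Real.log_nonneg hC)
      (mul_nonneg (by norm_num) (Real.log_natCast_nonneg b))]
  apply ENNReal.ofReal_le_ofReal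
  have hlC := Real.log_nonneg hC
  have hlb := Real.log_natCast_nonneg b
  rcases Nat.eq_zero_or_pos a with rfl | ha0
  · simp only [Nat.cast_zero, Real.log_zero]
    positivity
  · have hb0 : (b : ℝ) ≠ 0 := by
      intro h0
      rw [h0] at hab
      have : (0 : ℝ) < a := by exact_mod_cast ha0
      norm_num at hab
      linarith
    have := Real.log_le_log (by positivity) hab
    rw [Real.log_mul (by positivity) (by positivity), Real.log_pow] at this
    exact_mod_cast this

lemma eventually_weakFilter_mem : ∀ᶠ p : ℝ × ℕ+ in weakFilter, p.1 ∈ Set.Ioo (0 : ℝ) 1 :=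
  mem_inf_of_right (mem_principal_self _)

lemma tendsto_weakFilter_half :
    Tendsto (fun p : ℝ × ℕ+ => (p.1 / 2, p.2)) weakFilter weakFilter := by
  refine tendsto_inf.2 ⟨tendsto_comap_iff.2 ?_, tendsto_principal.2 ?_⟩
  · have h : Tendsto (fun p : ℝ × ℕ+ => p.1⁻¹ + (p.2 : ℝ)) weakFilter atTop :=
      tendsto_comap.mono_left inf_le_left
    refine tendsto_atTop_mono' _ ?_ h
    filter_upwards [eventually_weakFilter_mem] with p hp
    have := inv_pos.2 hp.1
    rw [Function.comp_apply, inv_div, div_eq_mul_inv]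
    linarith
  · filter_upwards [eventually_weakFilter_mem] with p hp
    exact ⟨by linarith [hp.1], by linarith [hp.1, hp.2]⟩

/-- If `ε⁻¹ + d ≥ B₁ + B₂`, one summand exceeds its own threshold, while the other function is
nonnegative. -/
lemma tendsto_weakFilter_add {g₁ g₂ : ℝ → ℝ} (h₁ : Tendsto g₁ atTop atTop)
    (h₂ : Tendsto g₂ atTop atTop) (hg₁ : ∀ x, 1 ≤ x → 0 ≤ g₁ x) (hg₂ : ∀ x, 1 ≤ x → 0 ≤ g₂ x) :
    Tendsto (fun p : ℝ × ℕ+ => g₁ p.1⁻¹ + g₂ (p.2 : ℝ)) weakFilter atTop := by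
  refine tendsto_atTop.2 fun R => ?_
  obtain ⟨B₁, hB₁⟩ := (tendsto_atTop.1 h₁ R).exists_forall_of_atTop
  obtain ⟨B₂, hB₂⟩ := (tendsto_atTop.1 h₂ R).exists_forall_of_atTop
  have h : Tendsto (fun p : ℝ × ℕ+ => p.1⁻¹ + (p.2 : ℝ)) weakFilter atTop :=
    tendsto_comap.mono_left inf_le_left
  filter_upwards [eventually_weakFilter_mem, h.eventually_ge_atTop (B₁ + B₂)] with p hp hB
  have hε : 1 ≤ p.1⁻¹ := ((one_lt_inv₀ hp.1).2 hp.2).le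
  have hd : (1 : ℝ) ≤ (p.2 : ℝ) := by exact_mod_cast one_le
  rcases le_or_gt B₁ p.1⁻¹ with h' | h'
  · linarith [hB₁ _ h', hg₂ _ hd]
  · linarith [hB₂ (p.2 : ℝ) (by linarith), hg₁ _ hε]

/-- Weak tractability with respect to a general denominator. -/
lemma AlmostDominates.tendsto_lnCard_div (h : AlmostDominates N M) {D : ℝ × ℕ+ → ℝ} {K : ℝ}
    (hK : 0 < K) (hD : Tendsto D weakFilter atTop)
    (hDK : ∀ p : ℝ × ℕ+, p.1 ∈ Set.Ioo (0 : ℝ) 1 → D (p.1 / 2, p.2) ≤ K * D p)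
    (hN : Tendsto (fun p : ℝ × ℕ+ => lnCard (N p.1 p.2) / ENNReal.ofReal (D p)) weakFilter (𝓝 0)) :
    Tendsto (fun p : ℝ × ℕ+ => lnCard (M p.1 p.2) / ENNReal.ofReal (D p)) weakFilter (𝓝 0) := by
  obtain ⟨C, hC, hb⟩ := h 1 one_pos le_rfl
  -- The constant disappears as `D → ∞`; the main term is the hypothesis at `ε / 2`, where `D` grows
  -- by at most the factor `K`.
  have h1 : Tendsto (fun p => ENNReal.ofReal (Real.log (max C 1)) / ENNReal.ofReal (D p))
      weakFilter (𝓝 0) :=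
    ENNReal.Tendsto.const_div (ENNReal.tendsto_ofReal_atTop.comp hD)
      (Or.inr ENNReal.ofReal_ne_top) |>.trans (by simp)
  have h2 := ENNReal.Tendsto.const_mul (a := 2 * ENNReal.ofReal K)
    (hN.comp tendsto_weakFilter_half)
    (Or.inr (ENNReal.mul_ne_top ENNReal.ofNat_ne_top ENNReal.ofReal_ne_top))
  have h3 := h1.add h2
  rw [mul_zero, add_zero] at h3
  refine tendsto_of_tendsto_of_tendsto_of_le_of_le' tendsto_const_nhds h3
    (Eventually.of_forall fun _ => zero_le) ?_
  filter_upwards [eventually_weakFilter_mem, hD.eventually_gt_atTop 0] with p hp hDp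
  have h4 : lnCard (M p.1 p.2) ≤ ENNReal.ofReal (Real.log (max C 1))
      + 2 * lnCard (N (p.1 / 2) p.2) := by
    refine lnCard_le_of_le (le_max_right _ _) ?_
    have h5 := hb p.2 p.1 hp.1
    rw [one_add_one_eq_two] at h5
    refine h5.trans ?_
    gcongr
    exact le_max_left _ _
  have h6 : (ENNReal.ofReal (D p))⁻¹ ≤
      ENNReal.ofReal K * (ENNReal.ofReal (D (p.1 / 2, p.2)))⁻¹ := by
    have h7 : ENNReal.ofReal (D (p.1 / 2, p.2)) ≤ ENNReal.ofReal K * ENNReal.ofReal (D p) := by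
      rw [← ENNReal.ofReal_mul hK.le]
      exact ENNReal.ofReal_le_ofReal (hDK p hp)
    have hK0 : ENNReal.ofReal K ≠ 0 := by simpa using hK
    calc (ENNReal.ofReal (D p))⁻¹
        = ENNReal.ofReal K * (ENNReal.ofReal K * ENNReal.ofReal (D p))⁻¹ := by
          rw [ENNReal.mul_inv (Or.inl hK0) (Or.inl ENNReal.ofReal_ne_top), ← mul_assoc,
            ENNReal.mul_inv_cancel hK0 ENNReal.ofReal_ne_top, one_mul]
      _ ≤ _ := by gcongr
  calc lnCard (M p.1 p.2) / ENNReal.ofReal (D p)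
      ≤ (ENNReal.ofReal (Real.log (max C 1)) + 2 * lnCard (N (p.1 / 2) p.2))
          / ENNReal.ofReal (D p) := by gcongr
    _ = ENNReal.ofReal (Real.log (max C 1)) / ENNReal.ofReal (D p)
          + 2 * lnCard (N (p.1 / 2) p.2) * (ENNReal.ofReal (D p))⁻¹ := by
        rw [ENNReal.add_div, div_eq_mul_inv (2 * _)]
    _ ≤ ENNReal.ofReal (Real.log (max C 1)) / ENNReal.ofReal (D p)
          + 2 * lnCard (N (p.1 / 2) p.2) *
            (ENNReal.ofReal K * (ENNReal.ofReal (D (p.1 / 2, p.2)))⁻¹) := by gcongr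
    _ = _ := by
        simp only [Function.comp_apply, div_eq_mul_inv]
        ring

lemma tendsto_lnCard_div_anti (hle : ∀ ε d, N ε d ≤ M ε d) {D : ℝ × ℕ+ → ℝ}
    (hM : Tendsto (fun p : ℝ × ℕ+ => lnCard (M p.1 p.2) / ENNReal.ofReal (D p)) weakFilter (𝓝 0)) :
    Tendsto (fun p : ℝ × ℕ+ => lnCard (N p.1 p.2) / ENNReal.ofReal (D p)) weakFilter (𝓝 0) :=
  tendsto_of_tendsto_of_tendsto_of_le_of_le tendsto_const_nhds hM (fun _ => zero_le)
    fun p => ENNReal.div_le_div_right (lnCard_mono (hle p.1 p.2)) _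

/-- Halving `ε` at most doubles `1 + log ε⁻¹`, whence the factor `2 ^ s`. -/
lemma AlmostDominates.expSTWT_iff (h : AlmostDominates N M) (hle : ∀ ε d, N ε d ≤ M ε d) {s t : ℝ}
    (hs : 0 < s) (ht : 0 < t) : ExpSTWT N s t ↔ ExpSTWT M s t := by
  refine ⟨fun hN => h.tendsto_lnCard_div (K := 2 ^ s) (by positivity) ?_ (fun p hp => ?_) hN,
    tendsto_lnCard_div_anti hle⟩
  · refine tendsto_weakFilter_add (g₁ := fun x => (1 + Real.log x) ^ s) (g₂ := fun x => x ^ t)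
      ((tendsto_rpow_atTop hs).comp (tendsto_atTop_add_const_left _ _ Real.tendsto_log_atTop))
      (tendsto_rpow_atTop ht) (fun x hx => ?_) (fun x hx => by positivity)
    have := Real.log_nonneg hx
    positivity
  · have hx := log_inv_pos hp
    have h2 : Real.log (p.1 / 2)⁻¹ = Real.log p.1⁻¹ + Real.log 2 := by
      have := log_inv_div hp.1 one_pos
      rwa [one_add_one_eq_two] at this
    have h3 : Real.log 2 ≤ 1 := by linarith [Real.log_two_lt_d9]
    have h4 : 0 < Real.log 2 := Real.log_pos one_lt_two
    simp only [h2]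
    rw [mul_add, ← Real.mul_rpow (by norm_num) (by positivity)]
    refine add_le_add ?_ (le_mul_of_one_le_left (by positivity)
      (Real.one_le_rpow (by norm_num) hs.le))
    gcongr
    linarith

lemma AlmostDominates.algSTWT_iff (h : AlmostDominates N M) (hle : ∀ ε d, N ε d ≤ M ε d) {s t : ℝ}
    (hs : 0 < s) (ht : 0 < t) : AlgSTWT N s t ↔ AlgSTWT M s t := by
  refine ⟨fun hN => h.tendsto_lnCard_div (K := 2 ^ s) (by positivity) ?_ (fun p hp => ?_) hN,
    tendsto_lnCard_div_anti hle⟩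
  · exact tendsto_weakFilter_add (g₁ := fun x => x ^ s) (g₂ := fun x => x ^ t)
      (tendsto_rpow_atTop hs) (tendsto_rpow_atTop ht) (fun x hx => by positivity)
      (fun x hx => by positivity)
  · have hx := inv_pos.2 hp.1
    rw [inv_div, div_eq_mul_inv, mul_add, Real.mul_rpow (by norm_num) hx.le]
    gcongr
    exact le_mul_of_one_le_left (by positivity) (Real.one_le_rpow (by norm_num) hs.le)

lemma expWT_iff_expSTWT : ExpWT N ↔ ExpSTWT N 1 1 := by
  unfold ExpWT ExpSTWT
  simp_rw [Real.rpow_one]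

end Tractability
end RandApprox

theorem theorem2p6 (APP : (d : ℕ+) → RandApprox.ApproxProblem.{u} d) (c : RandApprox.Criterion)
    (Λ : RandApprox.InfoClass)
    (hΛ : Λ = RandApprox.InfoClass.std ∨ Λ = RandApprox.InfoClass.stdAE) :
    let Nall := RandApprox.infoComplexity APP c RandApprox.InfoClass.all
    let Nstd := RandApprox.infoComplexity APP c Λ
    (RandApprox.ExpSPT Nall ↔ RandApprox.ExpSPT Nstd) ∧
    (RandApprox.ExpPT Nall ↔ RandApprox.ExpPT Nstd) ∧
    (RandApprox.ExpQPT Nall ↔ RandApprox.ExpQPT Nstd) ∧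
    (RandApprox.ExpUWT Nall ↔ RandApprox.ExpUWT Nstd) ∧
    (RandApprox.ExpWT Nall ↔ RandApprox.ExpWT Nstd) ∧
    (∀ s t : ℝ, 0 < s → 0 < t → (RandApprox.ExpSTWT Nall s t ↔ RandApprox.ExpSTWT Nstd s t)) ∧
    (RandApprox.AlgUWT Nall ↔ RandApprox.AlgUWT Nstd) ∧
    (∀ s t : ℝ, 0 < s → 0 < t → (RandApprox.AlgSTWT Nall s t ↔ RandApprox.AlgSTWT Nstd s t)) ∧
    RandApprox.expSPTExponent Nall = RandApprox.expSPTExponent Nstd ∧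
    RandApprox.expQPTExponent Nall = RandApprox.expQPTExponent Nstd := by
  intro Nall Nstd
  have hle : ∀ ε d, Nall ε d ≤ Nstd ε d := RandApprox.infoComplexity_all_le APP c Λ
  have h : RandApprox.AlmostDominates Nall Nstd := fun δ hδ hδ1 =>
    RandApprox.exists_infoComplexity_std_le hδ hδ1 APP c hΛ
  -- For the properties themselves `δ = 1` suffices; arbitrarily small `δ` matters only for the
  -- exponents.
  refine ⟨⟨fun ⟨p, hp, hN⟩ => ⟨_, by positivity, h.expSPTBound hp hN one_pos le_rfl⟩,
      fun ⟨p, hp, hM⟩ => ⟨p, hp, hM.anti hle⟩⟩,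
    ⟨h.expPT, fun hM => hM.anti hle⟩,
    ⟨fun ⟨t, ht, hN⟩ => ⟨_, by positivity, h.expQPTBound ht hN one_pos le_rfl⟩,
      fun ⟨t, ht, hM⟩ => ⟨t, ht, hM.anti hle⟩⟩,
    forall₄_congr fun s t hs ht => h.expSTWT_iff hle hs ht, ?_,
    fun s t hs ht => h.expSTWT_iff hle hs ht,
    forall₄_congr fun s t hs ht => h.algSTWT_iff hle hs ht,
    fun s t hs ht => h.algSTWT_iff hle hs ht,
    h.expSPTExponent_eq hle, h.expQPTExponent_eq hle⟩
  rw [RandApprox.expWT_iff_expSTWT, RandApprox.expWT_iff_expSTWT]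
  exact h.expSTWT_iff hle one_pos one_pos
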